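/- Write permutations of $[m]=\{1,\dots,m\}$ in one-line notation. The pinnacle set of $\pi=\pi_1\cdots\pi_m$ is $\operatorname{Pin}\pi=\{\pi_i \mid 1<i<m,\ \pi_{i-1}<\pi_i>\pi_{i+1}\}$, and a finite set $S$ of positive integers is called admissible if $S=\operatorname{Pin}\pi$ for some permutation $\pi$ of some $[m]$. Let $d\ge 1$, let $S=\{s_1<\dots<s_d\}$ be admissible, let $n\ge s_d$, and put $s_0=0$, $s_{d+1}=n+1$, $S'=S\cup\{n+1\}$ and $n_i=s_{i+1}-s_i-1$ for $0\le i\le d$. A permutation $\sigma$ of $S$ is an admissible ordering of $S$ if there is a permutation $\pi$ of $[n]$ with $\operatorname{Pin}\pi=S$ whose pinnacles occur in $\pi$ in the same order as in $\sigma$; let $\mathcal O(S)$ be the set of admissible orderings of $S$. Let $D=\{1_l<1_r<2_l<2_r<\dots<d_l<d_r\}$, where $i_l$ and $i_r$ have rank $i$, and $D'=D\setminus\{1_l,1_r\}$. For $B\subseteq D$ and $1\le j\le \#B$ let $r_j=r_j(B)$ be the rank of the $j$th smallest element of $B$, and let $\delta_B=1$ if $j\le n_0+n_1+\dots+n_{r_j(B)-1}$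 for all $1\le j\le\#B$, and $\delta_B=0$ otherwise. A cyclic permutation $[\pi]$ is the class of a permutation $\pi$ under rotation, and $\operatorname{Pin}[\pi]$ is the set of entries that are larger than both of their cyclic neighbours. A cyclic ordering $[\tau]=[\tau_1\cdots\tau_{d+1}]$ of $1,\dots,d+1$ is called admissible if there is a cyclic permutation $[\pi]$ of $[n+1]$ with $\operatorname{Pin}[\pi]=S'$ whose pinnacles occur in the cyclic order $[s_{\tau_1}\cdots s_{\tau_{d+1}}]$. Its dale rank set $D_{[\tau]}\subseteq D$ consists of all $i_r$ such that the entry directly after $i$ in $[\tau]$ is larger than $i$, and all $i_l$ such that the entry directly before $i$ in $[\tau]$ is larger than $i$. Theorem. (a) A cyclic ordering $[\tau]$ of $1,\dots,d+1$ is admissible if and only if, with $r_j=r_j(D_{[\tau]})$, $$j\le n_0+n_1+\dots+n_{r_j-1}\qquad\text{for all } j\in[d+1].$$ (b) $$\#\mathcal O(S)=\sum_{B\subseteq D',\ \#B=d-1}\delta_{B\cup\{1_l,1_r\}}\prod_{i=0}^{d-2}\bigl(d+1-i-r_{d-1-i}(B)\bigr).$$ -/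

import Mathlib

namespace Pinnacle

/-- The list `σ` lists every element of `A` exactly once, i.e. it is a permutation of `A` in
one-line notation. For `A = Finset.Icc 1 n` these are the elements of the symmetric group on
`{1, …, n}`. -/
def IsOrdering (A : Finset ℕ) (σ : List ℕ) : Prop :=
  σ.Nodup ∧ σ.toFinset = A

/-- The pinnacle set of a linear word: all entries that are larger than both of their neighbours
(the first and the last entry are never pinnacles). -/
def pin (π : List ℕ) : Set ℕ :=
  {y | ∃ x z, [x, y, z] <:+: π ∧ x < y ∧ z < y}

/-- `S` is an admissible pinnacle set: it is the pinnacle set of a permutation of some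
`{1, …, m}`. -/
def IsAdmissibleSet (S : Finset ℕ) : Prop :=
  ∃ (m : ℕ) (π : List ℕ), IsOrdering (Finset.Icc 1 m) π ∧ pin π = ↑S

/-- The set `𝒪(S)` of admissible orderings of `S`: the permutations `σ` of `S` for which some
permutation `π` of `{1, …, n}` has pinnacle set `S`, with its pinnacles occurring in the order
given by `σ`. -/
def admissibleOrderings (n : ℕ) (S : Finset ℕ) : Set (List ℕ) :=
  {σ | IsOrdering S σ ∧ ∃ π : List ℕ, IsOrdering (Finset.Icc 1 n) π ∧ pin π = ↑S ∧
    π.filter (fun x => x ∈ S) = σ}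

theorem admissibleOrderings_finite (n : ℕ) (S : Finset ℕ) :
    (admissibleOrderings n S).Finite := by
  refine (S.toList.permutations.toFinset.finite_toSet).subset ?_
  rintro σ ⟨⟨h1, h2⟩, -⟩
  have h : σ.Perm S.toList := by
    rw [← h2]
    exact (List.toFinset_toList h1).symm
  simpa using h

/-- The numbers `s_i`: `s_0 = 0`, `s_1 < … < s_d` are the elements of `S`, and
`s_{d+1} = n + 1`. -/
def s (n : ℕ) (S : Finset ℕ) (i : ℕ) : ℕ :=
  (0 :: (S.sort (· ≤ ·) ++ [n + 1])).getD i 0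

/-- The gap `n_i = s_{i+1} - s_i - 1`, the number of integers strictly between `s_i` and
`s_{i+1}` (for `0 ≤ i ≤ d` and `S ⊆ {1, …, n}` the subtraction does not truncate). -/
def gap (n : ℕ) (S : Finset ℕ) (i : ℕ) : ℕ :=
  s n S (i + 1) - s n S i - 1

/-- Dale ranks `i_l` and `i_r` with the order `1_l < 1_r < 2_l < 2_r < …`. -/
abbrev Dale : Type := ℕ ×ₗ Bool

/-- The left dale rank `i_l`. -/
def left (i : ℕ) : Dale := toLex (i, false)

/-- The right dale rank `i_r`. -/
def right (i : ℕ) : Dale := toLex (i, true)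

/-- The master dale rank set `D = {1_l, 1_r, …, d_l, d_r}`. -/
def master (d : ℕ) : Finset Dale :=
  (Finset.Icc 1 d).image left ∪ (Finset.Icc 1 d).image right

/-- `rk B j` is `r_j`, the rank of the `j`-th smallest element of `B`, for `1 ≤ j ≤ #B`. -/
def rk (B : Finset Dale) (j : ℕ) : ℕ :=
  (ofLex ((B.sort (· ≤ ·)).getD (j - 1) (left 0))).1

/-- The condition `j ≤ n_0 + n_1 + ⋯ + n_{r_j - 1}` for all `1 ≤ j ≤ #B`. -/
def Fits (n : ℕ) (S : Finset ℕ) (B : Finset Dale) : Prop :=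
  ∀ j ∈ Finset.Icc 1 B.card, j ≤ ∑ i ∈ Finset.range (rk B j), gap n S i

open Classical in
/-- The indicator `δ_B`. -/
noncomputable def delta (n : ℕ) (S : Finset ℕ) (B : Finset Dale) : ℤ :=
  if Fits n S B then 1 else 0

/-- In the cycle `c`, the entry `y` comes directly after the entry `x`. -/
def Follows (c : Cycle ℕ) (x y : ℕ) : Prop :=
  ∃ l : List ℕ, ((x :: y :: l : List ℕ) : Cycle ℕ) = c

/-- The pinnacle set of a cyclic permutation: all entries that are larger than both of their
cyclic neighbours (which coincide in a cycle of length two). -/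
def cyclicPin (c : Cycle ℕ) : Set ℕ :=
  {y | ∃ x z, Follows c x y ∧ Follows c y z ∧ x < y ∧ z < y}

/-- `τ` is a cyclic permutation of `{1, …, m}`, i.e. an element of `[𝔖_m]`. -/
def IsCyclicPerm (m : ℕ) (τ : Cycle ℕ) : Prop :=
  τ.Nodup ∧ τ.toFinset = Finset.Icc 1 m

/-- The cyclic ordering `τ` of the indices `1, …, d + 1` of `S' = S ∪ {n + 1}` is admissible:
some cyclic permutation `[π]` of `{1, …, n + 1}` has pinnacle set `S'`, and the pinnacles
`s_1, …, s_{d+1}` occur in `[π]` in the cyclic order given by `τ`. -/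
def IsAdmissibleCyclic (n : ℕ) (S : Finset ℕ) (τ : Cycle ℕ) : Prop :=
  ∃ π : List ℕ, IsOrdering (Finset.Icc 1 (n + 1)) π ∧
    cyclicPin (π : Cycle ℕ) = ↑(insert (n + 1) S) ∧
    ((π.filter (fun x => x ∈ insert (n + 1) S) : List ℕ) : Cycle ℕ) = τ.map (s n S)

open Classical in
/-- The dale rank set `D_[τ]` of a cyclic ordering `τ` of `1, …, d + 1`. Every pair of cyclically
adjacent entries gives one dale, whose rank is the smaller entry `i`; it is `i_r` if the larger
entry comes directly after `i`, and `i_l` if the larger entry comes directly before `i`. -/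
noncomputable def daleSet (d : ℕ) (τ : Cycle ℕ) : Finset Dale :=
  ((Finset.Icc 1 d).filter (fun i => ∃ k, Follows τ k i ∧ i < k)).image left ∪
    ((Finset.Icc 1 d).filter (fun i => ∃ k, Follows τ i k ∧ i < k)).image right

end Pinnacle

open Pinnacle

namespace Pinnacle

/-! Cutting a cycle at its maximum `n + 1` makes it a permutation of `{1, …, n}`. The cut entry is
always a cyclic pinnacle, and the other cyclic pinnacles are the linear ones. So admissible cyclic
orderings correspond to `𝒪(S)`, and part (a) also reduces part (b) to counting cycles by dale rank
set.

For (a), consecutive pinnacles of ranks `x`, `y` must be separated by non-pinnacles. The separating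
word contains one below the smaller of `s_x`, `s_y`, that is, below `s_r` where `r` is the rank of
the dale. Distinct gaps give distinct values, so at most `#(lowers S s_r)` dales have rank at most
`r`. As `#(lowers S s_r) = n_0 + ⋯ + n_{r-1}`, this is the stated inequality in counting form
(`fits_iff_card_le`). Conversely, these counts are Hall's condition for choosing distinct
non-pinnacles, one for each dale (`exists_injOn_lowers`). The chosen values fill the gaps, and all
remaining non-pinnacles go into the first gap in decreasing order, where they create no new pinnacle
(`exists_ordering_of_card_le`).

For (b), inserting a new maximum into a cycle adds exactly one dale, and any dale missing from the
cycle, of rank at most the old maximum, can be added in exactly one way. Hence the number of cycles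
on `1, …, m + 1` with dale set `D` is the sum over `e ∈ D` of the numbers on `1, …, m` with dale set
`D \ {e}` (`dalesCount_succ`). The product in (b) obeys the same recursion: the sum over erasures
telescopes (`sum_slotProd_erase`) and the boundary terms vanish. Grouping the cycles by dale set
gives the formula. -/

/-! ### Cycles as words with a fixed first letter -/

theorem isRotated_iff_exists_append {α : Type*} {l l' : List α} :
    l ~r l' ↔ ∃ p q, l = p ++ q ∧ l' = q ++ p := by
  constructor
  · intro h
    obtain ⟨k, hk, rfl⟩ := List.isRotated_iff_mod.1 h
    exact ⟨l.take k, l.drop k, (List.take_append_drop k l).symm,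
      List.rotate_eq_drop_append_take hk⟩
  · rintro ⟨p, q, rfl, rfl⟩
    exact List.isRotated_append

theorem cons_isRotated_cons_iff {α : Type*} {x : α} {l l' : List α} (h : (x :: l).Nodup) :
    (x :: l) ~r (x :: l') ↔ l = l' := by
  constructor
  · intro hr
    obtain ⟨p, q, h1, h2⟩ := isRotated_iff_exists_append.1 hr
    cases p with
    | nil =>
      simp only [List.nil_append, List.append_nil] at h1 h2
      rw [← h2] at h1
      exact (List.cons.inj h1).2
    | cons a p =>
      cases q with
      | nil =>
        simp only [List.nil_append, List.append_nil] at h1 h2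
        rw [← h2] at h1
        exact (List.cons.inj h1).2
      | cons b q =>
        simp only [List.cons_append, List.cons.injEq] at h1 h2
        obtain ⟨rfl, rfl⟩ := h1
        obtain ⟨rfl, -⟩ := h2
        simp at h
  · rintro rfl
    exact List.IsRotated.refl _

theorem exists_coe_cons_eq {α : Type*} {c : Cycle α} {x : α} (h : x ∈ c) :
    ∃ l : List α, ((x :: l : List α) : Cycle α) = c := by
  induction c using Quotient.inductionOn with
  | _ l =>
    obtain ⟨p, q, rfl⟩ := List.append_of_mem (show x ∈ l from h)
    exact ⟨q ++ p, Cycle.coe_eq_coe.2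
      (isRotated_iff_exists_append.2 ⟨x :: q, p, by simp, rfl⟩)⟩

/-- Rooting at a fixed letter selects one representative from each rotation class. The root is left
free because two different ones are needed: the maximum, to pass to linear orderings, and 1, to
count by dales. -/
theorem bijOn_coe_cons {A : Finset ℕ} {x : ℕ} (hx : x ∈ A) :
    Set.BijOn (fun l : List ℕ => ((x :: l : List ℕ) : Cycle ℕ))
      {l | IsOrdering (A.erase x) l} {c | c.Nodup ∧ c.toFinset = A} := by
  have key : ∀ l : List ℕ, IsOrdering (A.erase x) l ↔ IsOrdering A (x :: l) := by
    intro l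
    simp only [IsOrdering, List.nodup_cons, List.toFinset_cons]
    constructor
    · rintro ⟨h1, h2⟩
      have : x ∉ l := by rw [← List.mem_toFinset, h2]; simp
      exact ⟨⟨this, h1⟩, by rw [h2, Finset.insert_erase hx]⟩
    · rintro ⟨⟨h0, h1⟩, h2⟩
      exact ⟨h1, by rw [← h2, Finset.erase_insert (by simpa using h0)]⟩
  refine ⟨fun l hl => ?_, fun l hl l' _ h => ?_, fun c hc => ?_⟩
  · have := (key l).1 hl
    exact ⟨Cycle.nodup_coe_iff.2 this.1, by simpa using this.2⟩
  · exact (cons_isRotated_cons_iff ((key l).1 hl).1).1 (Cycle.coe_eq_coe.1 h)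
  · have hxc : x ∈ c := by
      have : x ∈ c.toFinset := by rw [hc.2]; exact hx
      induction c using Quotient.inductionOn with
      | _ l => simpa using this
    obtain ⟨l, rfl⟩ := exists_coe_cons_eq hxc
    refine ⟨l, (key l).2 ⟨Cycle.nodup_coe_iff.1 hc.1, by simpa using hc.2⟩, rfl⟩

/-- Repeating the root at the end turns the wrap-around pair into an ordinary factor. A one-letter
cycle is excluded: its closed word would make `x` follow itself, whereas `Follows` requires a
representative of length at least two. -/
theorem follows_coe_cons_iff {x a b : ℕ} {l : List ℕ} (hl : l ≠ []) :
    Follows ((x :: l : List ℕ) : Cycle ℕ) a b ↔ [a, b] <:+: x :: l ++ [x] := by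
  constructor
  · rintro ⟨m, hm⟩
    obtain ⟨p, q, h1, h2⟩ := isRotated_iff_exists_append.1 (Cycle.coe_eq_coe.1 hm)
    rcases p with _ | ⟨a', _ | ⟨b', p⟩⟩
    · simp only [List.nil_append, List.append_nil] at h1 h2
      rw [h2, ← h1]
      exact ⟨[], m ++ [x], by simp⟩
    · simp only [List.cons_append, List.nil_append, List.cons.injEq] at h1
      obtain ⟨rfl, rfl⟩ := h1
      simp only [List.cons_append, List.cons.injEq] at h2
      obtain ⟨rfl, rfl⟩ := h2
      exact ⟨x :: m, [], by simp⟩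
    · simp only [List.cons_append, List.cons.injEq] at h1
      obtain ⟨rfl, rfl, rfl⟩ := h1
      rw [h2]
      exact ⟨q, p ++ [x], by simp⟩
  · rintro ⟨u, v, h⟩
    rcases List.eq_nil_or_concat v with rfl | ⟨v, z, rfl⟩
    · have h' : (u ++ [a]) ++ [b] = (x :: l) ++ [x] := by simpa using h
      obtain ⟨h1, h2⟩ := List.append_inj' h' rfl
      obtain rfl : b = x := by simpa using h2
      rcases u with _ | ⟨y, u⟩
      · simp only [List.nil_append, List.cons.injEq] at h1
        exact absurd h1.2.symm hl
      · simp only [List.cons_append, List.cons.injEq] at h1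
        obtain ⟨rfl, rfl⟩ := h1
        exact ⟨u, Cycle.coe_eq_coe.2
          (isRotated_iff_exists_append.2 ⟨[a], y :: u, by simp, by simp⟩)⟩
    · have h' : (u ++ a :: b :: v) ++ [z] = (x :: l) ++ [x] := by simpa using h
      obtain ⟨h1, -⟩ := List.append_inj' h' rfl
      rw [← h1]
      exact ⟨v ++ u, Cycle.coe_eq_coe.2
        (isRotated_iff_exists_append.2 ⟨a :: b :: v, u, by simp, by simp⟩)⟩

/-! ### Dales of a word and the dale rank set -/

/-- The dale between two adjacent ranks `x` and `y`. -/
def pairDale (x y : ℕ) : Dale := if x < y then right x else left y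

/-- The dales between consecutive entries of a word of ranks. -/
def dales : List ℕ → List Dale
  | x :: y :: l => pairDale x y :: dales (y :: l)
  | _ => []

@[simp] theorem dales_nil : dales [] = [] := rfl
@[simp] theorem dales_singleton (x : ℕ) : dales [x] = [] := rfl
@[simp] theorem dales_cons_cons (x y : ℕ) (l : List ℕ) :
    dales (x :: y :: l) = pairDale x y :: dales (y :: l) := rfl

theorem left_ne_right (i j : ℕ) : left i ≠ right j := by
  simp [left, right]

theorem left_inj {i j : ℕ} : left i = left j ↔ i = j := by
  simp [left]

theorem right_inj {i j : ℕ} : right i = right j ↔ i = j := by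
  simp [right]

theorem eq_left_or_right (e : Dale) : (∃ i, e = left i) ∨ ∃ i, e = right i := by
  obtain ⟨⟨i, _ | _⟩, rfl⟩ := toLex.surjective e
  · exact Or.inl ⟨i, rfl⟩
  · exact Or.inr ⟨i, rfl⟩

theorem right_eq_pairDale_iff {i x y : ℕ} : right i = pairDale x y ↔ i = x ∧ x < y := by
  unfold pairDale
  split_ifs with h
  · simp [right_inj, h]
  · simp [h, (left_ne_right _ _).symm]

theorem left_eq_pairDale_iff {i x y : ℕ} : left i = pairDale x y ↔ i = y ∧ y ≤ x := by
  unfold pairDale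
  split_ifs with h
  · simp [left_ne_right, h]
  · simp [left_inj, not_lt.1 h]

theorem mem_dales_iff {e : Dale} {w : List ℕ} :
    e ∈ dales w ↔ ∃ x y, [x, y] <:+: w ∧ e = pairDale x y := by
  induction w with
  | nil => simp
  | cons a w ih =>
    cases w with
    | nil =>
      simp only [dales_singleton, List.not_mem_nil, false_iff]
      rintro ⟨x, y, h, -⟩
      have := h.length_le
      simp at this
    | cons b w =>
      rw [dales_cons_cons, List.mem_cons, ih]
      constructor
      · rintro (rfl | ⟨x, y, h, rfl⟩)
        · exact ⟨a, b, ⟨[], w, by simp⟩, rfl⟩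
        · exact ⟨x, y, List.infix_cons_iff.2 (Or.inr h), rfl⟩
      · rintro ⟨x, y, h, rfl⟩
        rcases List.infix_cons_iff.1 h with h | h
        · simp only [List.cons_prefix_cons, List.nil_prefix, and_true] at h
          obtain ⟨rfl, rfl⟩ := h
          exact Or.inl rfl
        · exact Or.inr ⟨x, y, h, rfl⟩

theorem right_mem_dales_iff {i : ℕ} {w : List ℕ} :
    right i ∈ dales w ↔ ∃ k, [i, k] <:+: w ∧ i < k := by
  rw [mem_dales_iff]
  constructor
  · rintro ⟨x, y, h, he⟩
    obtain ⟨rfl, h'⟩ := right_eq_pairDale_iff.1 he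
    exact ⟨y, h, h'⟩
  · rintro ⟨k, h, h'⟩
    exact ⟨i, k, h, right_eq_pairDale_iff.2 ⟨rfl, h'⟩⟩

theorem left_mem_dales_iff {i : ℕ} {w : List ℕ} :
    left i ∈ dales w ↔ ∃ k, [k, i] <:+: w ∧ i ≤ k := by
  rw [mem_dales_iff]
  constructor
  · rintro ⟨x, y, h, he⟩
    obtain ⟨rfl, h'⟩ := left_eq_pairDale_iff.1 he
    exact ⟨x, h, h'⟩
  · rintro ⟨k, h, h'⟩
    exact ⟨k, i, h, left_eq_pairDale_iff.2 ⟨rfl, h'⟩⟩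

theorem length_dales (w : List ℕ) : (dales w).length = w.length - 1 := by
  induction w with
  | nil => rfl
  | cons a w ih =>
    cases w with
    | nil => rfl
    | cons b w => simp [ih]

theorem dales_append_cons (u : List ℕ) (a : ℕ) (v : List ℕ) :
    dales (u ++ a :: v) = dales (u ++ [a]) ++ dales (a :: v) := by
  induction u with
  | nil => simp
  | cons x u ih =>
    cases u with
    | nil => simp
    | cons y u => simpa using ih

theorem mem_left_of_infix_concat {i k b : ℕ} {w : List ℕ} (h : [i, k] <:+: w ++ [b]) : i ∈ w := by
  obtain ⟨u, v, h⟩ := h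
  rcases List.eq_nil_or_concat v with rfl | ⟨v, z, rfl⟩
  · have h' : (u ++ [i]) ++ [k] = w ++ [b] := by simpa using h
    rw [← (List.append_inj' h' rfl).1]
    simp
  · have h' : (u ++ i :: k :: v) ++ [z] = w ++ [b] := by simpa using h
    rw [← (List.append_inj' h' rfl).1]
    simp

theorem mem_right_of_infix_cons {i k a : ℕ} {w : List ℕ} (h : [i, k] <:+: a :: w) : k ∈ w := by
  rcases List.infix_cons_iff.1 h with h | h
  · rw [List.cons_prefix_cons] at h
    exact h.2.subset (by simp)
  · exact h.subset (by simp)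

/-- A right dale of rank `i` comes from the pair starting at `i`, a left one from the pair ending at
`i`, and each letter starts and ends at most one pair. The end letters `a` and `b` may be equal,
which is the closed-word case. -/
theorem nodup_dales {a b : ℕ} {l : List ℕ} (hl : l.Nodup) (ha : a ∉ l) (hb : b ∉ l) :
    (dales (a :: l ++ [b])).Nodup := by
  induction l generalizing a with
  | nil => simp
  | cons y l ih =>
    rw [List.nodup_cons] at hl
    simp only [List.mem_cons, not_or] at ha hb
    simp only [List.cons_append, dales_cons_cons, List.nodup_cons]
    refine ⟨fun hmem => ?_, by simpa using ih hl.2 hl.1 hb.2⟩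
    rcases lt_or_ge a y with h | h
    · rw [show pairDale a y = right a from (right_eq_pairDale_iff.2 ⟨rfl, h⟩).symm,
        right_mem_dales_iff] at hmem
      obtain ⟨k, hk, -⟩ := hmem
      have := mem_left_of_infix_concat (w := y :: l) hk
      simp [ha] at this
    · rw [show pairDale a y = left y from (left_eq_pairDale_iff.2 ⟨rfl, h⟩).symm,
        left_mem_dales_iff] at hmem
      obtain ⟨k, hk, -⟩ := hmem
      have := mem_right_of_infix_cons hk
      simp [hl.1, Ne.symm hb.1] at this

theorem ne_of_infix_closed {x a b : ℕ} {l : List ℕ} (h : (x :: l).Nodup) (hl : l ≠ [])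
    (hi : [a, b] <:+: x :: l ++ [x]) : a ≠ b := by
  rintro rfl
  rw [List.nodup_cons] at h
  obtain ⟨u, v, hi⟩ := hi
  rcases u with _ | ⟨y, u⟩
  · simp only [List.nil_append, List.cons_append, List.cons.injEq] at hi
    obtain ⟨rfl, hi⟩ := hi
    cases l with
    | nil => exact hl rfl
    | cons z l =>
      simp only [List.cons_append, List.cons.injEq] at hi
      obtain ⟨rfl, -⟩ := hi
      simp at h
  · simp only [List.cons_append, List.cons.injEq] at hi
    obtain ⟨rfl, hi⟩ := hi
    rcases List.eq_nil_or_concat v with rfl | ⟨v, z, rfl⟩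
    · have h' : (u ++ [a]) ++ [a] = l ++ [y] := by simpa using hi
      obtain ⟨h1, h2⟩ := List.append_inj' h' rfl
      apply h.1
      rw [← h1]
      simp [show y = a by simpa using h2.symm]
    · have h' : (u ++ a :: a :: v) ++ [z] = l ++ [y] := by simpa using hi
      have := h.2
      rw [← (List.append_inj' h' rfl).1, List.nodup_append] at this
      simp at this

theorem daleSet_coe_cons {d x : ℕ} {l : List ℕ} (h : IsOrdering (Finset.Icc 1 (d + 1)) (x :: l))
    (hl : l ≠ []) : daleSet d ((x :: l : List ℕ) : Cycle ℕ) = (dales (x :: l ++ [x])).toFinset := by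
  have hmem : ∀ {i k : ℕ}, [i, k] <:+: x :: l ++ [x] →
      i ∈ Finset.Icc 1 (d + 1) ∧ k ∈ Finset.Icc 1 (d + 1) := by
    intro i k hik
    have hsub : ∀ z ∈ x :: l ++ [x], z ∈ Finset.Icc 1 (d + 1) := by
      intro z hz
      rw [← h.2, List.mem_toFinset]
      simp only [List.cons_append, List.mem_cons, List.mem_append, List.not_mem_nil] at hz ⊢
      tauto
    exact ⟨hsub _ (hik.subset (by simp)), hsub _ (hik.subset (by simp))⟩
  ext e
  rcases eq_left_or_right e with ⟨i, rfl⟩ | ⟨i, rfl⟩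
  · simp only [daleSet, Finset.mem_union, Finset.mem_image, Finset.mem_filter, left_inj,
      (left_ne_right _ _).symm, and_false, exists_false, or_false, exists_eq_right,
      List.mem_toFinset, left_mem_dales_iff, follows_coe_cons_iff hl]
    constructor
    · rintro ⟨-, k, hk, hik⟩
      exact ⟨k, hk, hik.le⟩
    · rintro ⟨k, hk, hik⟩
      -- `pairDale` puts equality on the left-dale side, so strictness must come from the
      -- distinctness of neighbours. It also gives `i ≤ d`.
      have hlt := lt_of_le_of_ne hik (ne_of_infix_closed h.1 hl hk).symm
      have := hmem hk
      simp only [Finset.mem_Icc] at this ⊢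
      exact ⟨by omega, k, hk, hlt⟩
  · simp only [daleSet, Finset.mem_union, Finset.mem_image, Finset.mem_filter, right_inj,
      left_ne_right, and_false, exists_false, false_or, exists_eq_right,
      List.mem_toFinset, right_mem_dales_iff, follows_coe_cons_iff hl]
    constructor
    · rintro ⟨-, k, hk, hik⟩
      exact ⟨k, hk, hik⟩
    · rintro ⟨k, hk, hik⟩
      have := hmem hk
      simp only [Finset.mem_Icc] at this ⊢
      exact ⟨by omega, k, hk, hik⟩

theorem card_daleSet_coe_cons {d x : ℕ} {l : List ℕ}
    (h : IsOrdering (Finset.Icc 1 (d + 1)) (x :: l)) (hl : l ≠ []) :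
    (daleSet d ((x :: l : List ℕ) : Cycle ℕ)).card = d + 1 := by
  have hn := List.nodup_cons.1 h.1
  rw [daleSet_coe_cons h hl, List.toFinset_card_of_nodup (nodup_dales hn.2 hn.1 hn.1),
    length_dales]
  have := List.toFinset_card_of_nodup h.1
  rw [h.2] at this
  simp at this
  simp
  omega

/-! ### Gap sums and the counting form of the inequalities -/

theorem s_zero (n : ℕ) (S : Finset ℕ) : s n S 0 = 0 := by simp [s]

theorem s_card_add_one (n : ℕ) (S : Finset ℕ) : s n S (S.card + 1) = n + 1 := by
  simp [s, List.getD_eq_getElem?_getD]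

theorem strictMonoOn_s {n : ℕ} {S : Finset ℕ} (hS : S ⊆ Finset.Icc 1 n) :
    StrictMonoOn (s n S) (Set.Iic (S.card + 1)) := by
  have hp : List.Pairwise (· < ·) (0 :: (S.sort (· ≤ ·) ++ [n + 1])) := by
    simp only [List.pairwise_cons, List.pairwise_append]
    refine ⟨?_, (Finset.sortedLT_sort S).pairwise, by simp, ?_⟩
    · intro a ha
      simp only [List.mem_append, Finset.mem_sort, List.mem_singleton] at ha
      rcases ha with ha | ha
      · have := Finset.mem_Icc.1 (hS ha); omega
      · omega
    · intro a ha b hb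
      simp only [List.mem_singleton] at hb
      have := Finset.mem_Icc.1 (hS ((Finset.mem_sort _).1 ha)); omega
  intro i hi j hj hij
  simp only [Set.mem_Iic] at hi hj
  have hi' : i < (0 :: (S.sort (· ≤ ·) ++ [n + 1])).length := by simp; omega
  have hj' : j < (0 :: (S.sort (· ≤ ·) ++ [n + 1])).length := by simp; omega
  unfold s
  rw [List.getD_eq_getElem _ _ hi', List.getD_eq_getElem _ _ hj']
  exact List.pairwise_iff_getElem.1 hp i j hi' hj' hij

theorem image_s_Icc (n : ℕ) (S : Finset ℕ) : (Finset.Icc 1 S.card).image (s n S) = S := by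
  have hs : ∀ i (h : i < (S.sort (· ≤ ·)).length), s n S (i + 1) = (S.sort (· ≤ ·))[i] := by
    intro i h
    simp [s, List.getD_eq_getElem?_getD, List.getElem?_append_left h, List.getElem?_eq_getElem h]
  ext x
  rw [← Finset.mem_sort (· ≤ ·) (s := S), List.mem_iff_getElem]
  simp only [Finset.mem_image, Finset.mem_Icc]
  constructor
  · rintro ⟨i, ⟨h1, h2⟩, rfl⟩
    obtain ⟨i, rfl⟩ := Nat.exists_eq_add_of_le' h1
    exact ⟨i, by simpa using h2, (hs i (by simpa using h2)).symm⟩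
  · rintro ⟨i, hi, rfl⟩
    exact ⟨i + 1, ⟨by omega, by simpa using hi⟩, hs i hi⟩

theorem s_lt_s_iff {n : ℕ} {S : Finset ℕ} (hS : S ⊆ Finset.Icc 1 n) {i j : ℕ}
    (hi : i ≤ S.card + 1) (hj : j ≤ S.card + 1) : s n S i < s n S j ↔ i < j :=
  (strictMonoOn_s hS).lt_iff_lt hi hj

theorem filter_lt_s {n : ℕ} {S : Finset ℕ} (hS : S ⊆ Finset.Icc 1 n) {r : ℕ}
    (hr : r ≤ S.card + 1) :
    S.filter (fun v => v < s n S r) = (Finset.Ico 1 r).image (s n S) := by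
  ext x
  simp only [Finset.mem_filter, Finset.mem_image, Finset.mem_Ico]
  constructor
  · rintro ⟨hx, hlt⟩
    rw [← image_s_Icc n S] at hx
    obtain ⟨i, hi, rfl⟩ := Finset.mem_image.1 hx
    rw [Finset.mem_Icc] at hi
    exact ⟨i, ⟨hi.1, (s_lt_s_iff hS (by omega) hr).1 hlt⟩, rfl⟩
  · rintro ⟨i, hi, rfl⟩
    refine ⟨?_, (s_lt_s_iff hS (by omega) hr).2 hi.2⟩
    exact (image_s_Icc n S).le (Finset.mem_image_of_mem _ (Finset.mem_Icc.2 ⟨hi.1, by omega⟩))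

/-- The entries smaller than `c` that are not in `S`. -/
def lowers (S : Finset ℕ) (c : ℕ) : Finset ℕ := Finset.Ico 1 c \ S

theorem mem_lowers {S : Finset ℕ} {c v : ℕ} : v ∈ lowers S c ↔ (1 ≤ v ∧ v < c) ∧ v ∉ S := by
  simp [lowers]

/-- The gaps telescope to `s_r - r`. Of the `s_r - 1` positive integers below `s_r`, exactly `r - 1`
lie in `S`. The case `r = 0` is separate because of truncated subtraction. -/
theorem sum_gap {n : ℕ} {S : Finset ℕ} (hS : S ⊆ Finset.Icc 1 n) {r : ℕ}
    (hr : r ≤ S.card + 1) :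
    ∑ i ∈ Finset.range r, gap n S i = (lowers S (s n S r)).card := by
  have h1 : ∀ k ≤ r, ∑ i ∈ Finset.range k, gap n S i + k = s n S k := by
    intro k
    induction k with
    | zero => simp [s_zero]
    | succ k ih =>
      intro hk
      have := (s_lt_s_iff hS (i := k) (j := k + 1) (by omega) (by omega)).2 (by omega)
      have := ih (by omega)
      rw [Finset.sum_range_succ, show gap n S k = s n S (k + 1) - s n S k - 1 from rfl]
      omega
  have h2 : (lowers S (s n S r)).card + (S.filter (fun v => v < s n S r)).card =
      (Finset.Ico 1 (s n S r)).card := by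
    rw [← Finset.card_union_of_disjoint]
    · congr 1
      ext v
      simp only [Finset.mem_union, mem_lowers, Finset.mem_filter, Finset.mem_Ico]
      constructor
      · rintro (h | ⟨h, h'⟩)
        · exact h.1
        · exact ⟨(Finset.mem_Icc.1 (hS h)).1, h'⟩
      · tauto
    · rw [Finset.disjoint_left]
      intro v hv hv'
      exact (mem_lowers.1 hv).2 (Finset.mem_filter.1 hv').1
  rw [filter_lt_s hS hr, Finset.card_image_of_injOn, Nat.card_Ico, Nat.card_Ico] at h2
  · have := h1 r le_rfl
    rcases Nat.eq_zero_or_pos r with rfl | h0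
    · simp [lowers, s_zero]
    · omega
  · intro i hi j hj hij
    simp only [Finset.coe_Ico, Set.mem_Ico] at hi hj
    exact (strictMonoOn_s hS).injOn (Set.mem_Iic.2 (by omega)) (Set.mem_Iic.2 (by omega)) hij

/-- The rank of a dale. -/
def rank (e : Dale) : ℕ := (ofLex e).1

@[simp] theorem rank_left (i : ℕ) : rank (left i) = i := rfl
@[simp] theorem rank_right (i : ℕ) : rank (right i) = i := rfl

theorem rank_mono : Monotone rank := by
  intro a b h
  rcases (Prod.Lex.le_iff).1 h with h | h
  · exact h.le
  · exact h.1.le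

theorem rk_eq_rank_getElem {B : Finset Dale} {j : ℕ} (h : j < (B.sort (· ≤ ·)).length) :
    rk B (j + 1) = rank ((B.sort (· ≤ ·))[j]) := by
  rw [rk, Nat.add_sub_cancel, List.getD_eq_getElem _ _ h, rank]

/-- If `c > 0` entries are at most `r`, then the `c`-th smallest is at most `r`, so monotonicity
carries its bound to `r`. Conversely, at least `j + 1` entries are at most `l[j]`. -/
theorem forall_succ_le_iff_forall_countP_le {l : List ℕ} (hl : l.Pairwise (· ≤ ·)) {N : ℕ → ℕ}
    (hN : ∀ i ∈ l, ∀ j, i ≤ j → N i ≤ N j) :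
    (∀ j (h : j < l.length), j + 1 ≤ N l[j]) ↔ ∀ r, l.countP (· ≤ r) ≤ N r := by
  constructor
  · intro h r
    by_contra! hc
    set c := l.countP (· ≤ r) with hcdef
    obtain ⟨c', hc'⟩ : ∃ c', c = c' + 1 := ⟨c - 1, by omega⟩
    have hlen : c' < l.length := by
      have : c ≤ l.length := List.countP_le_length
      omega
    have hle : l[c'] ≤ r := by
      by_contra! hgt
      have hsplit : l.countP (· ≤ r) = (l.take c').countP (· ≤ r) + (l.drop c').countP (· ≤ r) := by
        rw [← List.countP_append, List.take_append_drop]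
      have h0 : (l.drop c').countP (· ≤ r) = 0 := by
        rw [List.countP_eq_zero]
        intro a ha
        obtain ⟨k, hk, rfl⟩ := List.mem_iff_getElem.1 ha
        rw [List.getElem_drop]
        rw [List.length_drop] at hk
        have : l[c'] ≤ l[c' + k]'(by omega) := by
          rcases Nat.eq_zero_or_pos k with rfl | hk0
          · simp
          · exact List.pairwise_iff_getElem.1 hl _ _ _ _ (by omega)
        simp
        omega
      have h1 : (l.take c').countP (· ≤ r) ≤ c' := by
        refine List.countP_le_length.trans ?_
        simp
      omega
    have := h c' hlen
    have := hN _ (List.getElem_mem hlen) r hle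
    omega
  · intro h j hj
    refine le_trans ?_ (h l[j])
    have hsub : (l.take (j + 1)).countP (· ≤ l[j]) ≤ l.countP (· ≤ l[j]) :=
      (List.take_sublist _ _).countP_le
    refine le_trans (le_of_eq ?_) hsub
    symm
    have hlen : (l.take (j + 1)).length = j + 1 := by simp; omega
    conv_rhs => rw [← hlen]
    rw [List.countP_eq_length]
    intro a ha
    obtain ⟨k, hk, rfl⟩ := List.mem_iff_getElem.1 ha
    rw [List.getElem_take]
    rw [List.length_take] at hk
    rcases eq_or_ne k j with rfl | hne
    · simp
    · simpa using List.pairwise_iff_getElem.1 hl k j (by omega) hj (by omega)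

/-- Counting dales of bounded rank removes the sorting from `Fits`. The result is both what gap
counting yields and what Hall's theorem consumes. -/
theorem fits_iff_card_le {n : ℕ} {S : Finset ℕ} (hS : S ⊆ Finset.Icc 1 n) {B : Finset Dale}
    (hB : ∀ e ∈ B, rank e ≤ S.card + 1) :
    Fits n S B ↔ ∀ r ≤ S.card + 1,
      (B.filter (fun e => rank e ≤ r)).card ≤ (lowers S (s n S r)).card := by
  have hcount : ∀ r, ((B.sort (· ≤ ·)).map rank).countP (· ≤ r) =
      (B.filter (fun e => rank e ≤ r)).card := by
    intro r
    rw [List.countP_map, List.countP_eq_length_filter,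
      ← List.toFinset_card_of_nodup ((Finset.sort_nodup _ _).filter _)]
    congr 1
    ext e
    simp
  have h1 : Fits n S B ↔ ∀ j (h : j < ((B.sort (· ≤ ·)).map rank).length),
      j + 1 ≤ ∑ i ∈ Finset.range (((B.sort (· ≤ ·)).map rank)[j]), gap n S i := by
    constructor
    · intro h j hj
      have hj' : j < (B.sort (· ≤ ·)).length := by simpa using hj
      have := h (j + 1) (Finset.mem_Icc.2 ⟨by omega, by simpa using hj⟩)
      rwa [rk_eq_rank_getElem hj', ← List.getElem_map rank (h := hj)] at this
    · intro h j hj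
      rw [Finset.mem_Icc] at hj
      obtain ⟨j, rfl⟩ := Nat.exists_eq_add_of_le' hj.1
      have hj' : j < (B.sort (· ≤ ·)).length := by simp; omega
      rw [rk_eq_rank_getElem hj', ← List.getElem_map rank (h := by simpa using hj')]
      exact h j _
  rw [h1, forall_succ_le_iff_forall_countP_le (N := fun r => ∑ i ∈ Finset.range r, gap n S i)]
  · constructor
    · intro h r hr
      rw [← hcount, ← sum_gap hS hr]
      exact h r
    · intro h r
      -- Beyond `S.card + 1` no further dale is counted, while the gap sum can only grow.
      rcases le_total r (S.card + 1) with hr | hr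
      · rw [hcount]
        exact (h r hr).trans (sum_gap hS hr).ge
      · have := h _ le_rfl
        rw [← sum_gap hS le_rfl, Finset.filter_true_of_mem hB] at this
        rw [hcount]
        exact (Finset.card_filter_le _ _).trans (this.trans
          (Finset.sum_le_sum_of_subset (Finset.range_mono hr)))
  · exact ((Finset.pairwise_sort B _).map rank (fun _ _ h => rank_mono h))
  · intro i _ j hij
    exact Finset.sum_le_sum_of_subset (Finset.range_mono hij)

/-! ### Neighbours in duplicate-free words; from cyclic to linear pinnacles -/

theorem infix_of_infix_closed {N x y : ℕ} {p : List ℕ} (h : [x, y] <:+: N :: p ++ [N])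
    (hx : x ≠ N) (hy : y ≠ N) : [x, y] <:+: p := by
  rw [List.cons_append, List.infix_cons_iff] at h
  rcases h with h | h
  · rw [List.cons_prefix_cons] at h
    exact absurd h.1 hx
  · obtain ⟨u, v, h⟩ := h
    rcases List.eq_nil_or_concat v with rfl | ⟨v, z, rfl⟩
    · have h' : (u ++ [x]) ++ [y] = p ++ [N] := by simpa using h
      have := (List.append_inj' h' rfl).2
      exact absurd (by simpa using this) hy
    · have h' : (u ++ [x, y] ++ v) ++ [z] = p ++ [N] := by simpa using h
      exact ⟨u, v, (List.append_inj' h' rfl).1⟩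

theorem append_cons_inj_of_nodup {u v u' v' : List ℕ} {y : ℕ} (hp : (u ++ y :: v).Nodup)
    (h : u ++ y :: v = u' ++ y :: v') : u = u' ∧ v = v' := by
  rw [List.nodup_append', List.nodup_cons] at hp
  obtain ⟨h1, -, h2⟩ :=
    (List.append_cons_inj_of_notMem (fun hy => hp.2.2 hy (by simp)) hp.2.1.1).1 h
  exact ⟨h1, h2⟩

theorem succ_unique {x y z : ℕ} {p : List ℕ} (hp : p.Nodup) (h : [x, y] <:+: p)
    (h' : [x, z] <:+: p) : y = z := by
  obtain ⟨u, v, rfl⟩ := h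
  obtain ⟨u', v', h'⟩ := h'
  have := (append_cons_inj_of_nodup (u := u) (v := y :: v) (y := x) (u' := u') (v' := z :: v')
    (by simpa using hp) (by simpa using h'.symm)).2
  exact (List.cons.inj this).1

theorem pred_unique {x y z : ℕ} {p : List ℕ} (hp : p.Nodup) (h : [y, x] <:+: p)
    (h' : [z, x] <:+: p) : y = z := by
  obtain ⟨u, v, rfl⟩ := h
  obtain ⟨u', v', h'⟩ := h'
  have := (append_cons_inj_of_nodup (u := u ++ [y]) (v := v) (y := x) (u' := u' ++ [z]) (v' := v')
    (by simpa using hp) (by simpa using h'.symm)).1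
  simpa using (List.append_inj' this rfl).2

theorem infix_triple {x y z : ℕ} {p : List ℕ} (hp : p.Nodup) (h : [x, y] <:+: p)
    (h' : [y, z] <:+: p) : [x, y, z] <:+: p := by
  obtain ⟨u, v, rfl⟩ := h
  obtain ⟨u', v', h'⟩ := h'
  obtain ⟨-, rfl⟩ := append_cons_inj_of_nodup (u := u ++ [x]) (v := v) (y := y) (u' := u')
    (v' := z :: v') (by simpa using hp) (by simpa using h'.symm)
  exact ⟨u, v', by simp⟩

/-- The end letters of `p` are adjacent to the maximum `N`, hence are not cyclic pinnacles, just as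
they are not linear ones. All other letters of `p` keep their neighbours. -/
theorem cyclicPin_coe_cons {N : ℕ} {p : List ℕ} (hp : p.Nodup) (hp0 : p ≠ [])
    (hN : ∀ x ∈ p, x < N) : cyclicPin ((N :: p : List ℕ) : Cycle ℕ) = insert N (pin p) := by
  ext y
  simp only [cyclicPin, Set.mem_ofPred_eq, Set.mem_insert_iff, pin, follows_coe_cons_iff hp0]
  constructor
  · rintro ⟨x, z, hxy, hyz, h1, h2⟩
    by_cases hy : y = N
    · exact Or.inl hy
    · right
      have hyN : y < N := hN y (by
        have := mem_left_of_infix_concat hyz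
        simpa [hy] using this)
      exact ⟨x, z, infix_triple hp (infix_of_infix_closed hxy (by omega) hy)
        (infix_of_infix_closed hyz hy (by omega)), h1, h2⟩
  · rintro (rfl | ⟨x, z, h, h1, h2⟩)
    · obtain ⟨a, b, rfl⟩ := List.exists_cons_of_ne_nil hp0
      obtain ⟨q, c, hq⟩ := (List.eq_nil_or_concat (a :: b)).resolve_left hp0
      refine ⟨c, a, ⟨y :: q, [], ?_⟩, ⟨[], b ++ [y], by simp⟩, hN c (by simp [hq]),
        hN a (by simp)⟩
      rw [hq]; simp
    · obtain ⟨u, v, rfl⟩ := h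
      exact ⟨x, z, ⟨N :: u, z :: v ++ [N], by simp⟩, ⟨N :: u ++ [x], v ++ [N], by simp⟩, h1, h2⟩

theorem isOrdering_cons_iff {A : Finset ℕ} {x : ℕ} {l : List ℕ} :
    IsOrdering (insert x A) (x :: l) ∧ x ∉ A ↔ IsOrdering A l ∧ x ∉ A := by
  simp only [IsOrdering, List.nodup_cons, List.toFinset_cons]
  constructor
  · rintro ⟨⟨⟨h1, h2⟩, h3⟩, h4⟩
    refine ⟨⟨h2, ?_⟩, h4⟩
    rw [← Finset.erase_insert (a := x) (s := l.toFinset) (by simpa using h1), h3,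
      Finset.erase_insert h4]
  · rintro ⟨⟨h1, rfl⟩, h4⟩
    exact ⟨⟨⟨by simpa using h4, h1⟩, rfl⟩, h4⟩

theorem IsOrdering.cons {A : Finset ℕ} {x : ℕ} {l : List ℕ} (h : IsOrdering A l) (hx : x ∉ A) :
    IsOrdering (insert x A) (x :: l) :=
  (isOrdering_cons_iff.2 ⟨h, hx⟩).1

theorem IsOrdering.mem_iff {A : Finset ℕ} {x : ℕ} {l : List ℕ} (h : IsOrdering A l) :
    x ∈ l ↔ x ∈ A := by
  rw [← h.2, List.mem_toFinset]

theorem insert_Icc_one (n : ℕ) : insert (n + 1) (Finset.Icc 1 n) = Finset.Icc 1 (n + 1) := by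
  ext; simp; omega

theorem injOn_s {n : ℕ} {S : Finset ℕ} (hS : S ⊆ Finset.Icc 1 n) :
    Set.InjOn (s n S) {x | x ∈ Finset.Icc 1 S.card} := by
  intro x hx y hy hxy
  have hx' := Finset.mem_Icc.1 hx
  have hy' := Finset.mem_Icc.1 hy
  exact (strictMonoOn_s hS).injOn (Set.mem_Iic.2 (by omega)) (Set.mem_Iic.2 (by omega)) hxy

theorem isOrdering_map_s {n : ℕ} {S : Finset ℕ} (hS : S ⊆ Finset.Icc 1 n) {t : List ℕ}
    (ht : IsOrdering (Finset.Icc 1 S.card) t) : IsOrdering S (t.map (s n S)) :=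
  ⟨(List.nodup_map_iff_inj_on ht.1).2
      (fun _ hx _ hy h => injOn_s hS (ht.mem_iff.1 hx) (ht.mem_iff.1 hy) h),
    Eq.trans (by ext; simp [ht.mem_iff]) (image_s_Icc n S)⟩

theorem isAdmissibleCyclic_coe_cons_iff {n : ℕ} {S : Finset ℕ} (hS : S ⊆ Finset.Icc 1 n)
    (hS0 : S.Nonempty) {t : List ℕ} (ht : IsOrdering (Finset.Icc 1 S.card) t) :
    IsAdmissibleCyclic n S (((S.card + 1) :: t : List ℕ) : Cycle ℕ) ↔
      t.map (s n S) ∈ admissibleOrderings n S := by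
  have hnS : n + 1 ∉ S := fun h => by have := Finset.mem_Icc.1 (hS h); omega
  have hn : n + 1 ∉ Finset.Icc 1 n := by simp
  have hord := isOrdering_map_s hS ht
  have hne : ∀ p, IsOrdering (Finset.Icc 1 n) p → p ≠ [] := by
    rintro p hp rfl
    obtain ⟨x, hx⟩ := hS0
    have := hp.mem_iff.2 (hS hx)
    simp at this
  have hfilter : ∀ p, IsOrdering (Finset.Icc 1 n) p →
      (p.filter (fun x => x ∈ insert (n + 1) S)) = p.filter (fun x => x ∈ S) := by
    intro p hp
    apply List.filter_congr
    intro x hx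
    have : x ≠ n + 1 := by rintro rfl; exact hn (hp.mem_iff.1 hx)
    simp [this]
  have hpin : ∀ p, IsOrdering (Finset.Icc 1 n) p →
      (cyclicPin (((n + 1) :: p : List ℕ) : Cycle ℕ) = ↑(insert (n + 1) S) ↔ pin p = ↑S) := by
    intro p hp
    rw [cyclicPin_coe_cons hp.1 (hne p hp)
      (fun x hx => by have := Finset.mem_Icc.1 (hp.mem_iff.1 hx); omega), Finset.coe_insert]
    constructor
    · intro h
      have hnp : n + 1 ∉ pin p := by
        rintro ⟨x, z, h, -⟩
        exact hn (hp.mem_iff.1 (h.subset (by simp)))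
      have := congrArg (fun X => X \ {n + 1}) h
      -- Removing `n + 1` from both sides loses nothing, since neither `pin p` nor `S` contains it.
      simpa [Set.insert_sdiff_of_mem, Set.sdiff_singleton_eq_self, hnp, hnS] using this
    · intro h; rw [h]
  constructor
  · rintro ⟨π, hπ, hpinπ, hfilt⟩
    obtain ⟨p, hp⟩ := exists_coe_cons_eq (c := (π : Cycle ℕ)) (x := n + 1)
      (Cycle.mem_coe_iff.2 (hπ.mem_iff.2 (by simp)))
    have hrot := Cycle.coe_eq_coe.1 hp
    have hp1 : IsOrdering (Finset.Icc 1 n) p := by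
      have h1 : IsOrdering (insert (n + 1) (Finset.Icc 1 n)) ((n + 1) :: p) := by
        rw [insert_Icc_one, IsOrdering, ← hπ.2]
        exact ⟨hrot.nodup_iff.2 hπ.1, List.toFinset_eq_of_perm _ _ hrot.perm⟩
      exact (isOrdering_cons_iff.1 ⟨h1, hn⟩).1
    rw [← hp] at hpinπ
    refine ⟨hord, p, hp1, (hpin p hp1).1 hpinπ, ?_⟩
    rw [Cycle.map_coe, Cycle.coe_eq_coe, List.map_cons, s_card_add_one] at hfilt
    have hrf : (π.filter (fun x => x ∈ insert (n + 1) S)) ~r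
        (((n + 1) :: p).filter (fun x => x ∈ insert (n + 1) S)) := by
      obtain ⟨a, b, h1, h2⟩ := isRotated_iff_exists_append.1 hrot.symm
      rw [h1, h2, List.filter_append, List.filter_append]
      exact List.isRotated_append
    have h2 := hrf.symm.trans hfilt
    rw [List.filter_cons_of_pos (by simp), hfilter p hp1, cons_isRotated_cons_iff] at h2
    · exact h2
    · rw [List.nodup_cons]
      refine ⟨fun h => hnS (by simpa using (List.mem_filter.1 h).2), hp1.1.filter _⟩
  · rintro ⟨-, p, hp, hpinp, hf⟩
    refine ⟨(n + 1) :: p, ?_, (hpin p hp).2 hpinp, ?_⟩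
    · rw [← insert_Icc_one]; exact hp.cons hn
    · rw [List.filter_cons_of_pos (by simp), hfilter p hp, hf, Cycle.map_coe, List.map_cons,
        s_card_add_one]

/-! ### Necessity: every dale uses up a small non-pinnacle -/

/-- Adjacent entries `x`, `y` of a word never violate that elements of `S` are pinnacles. -/
def PeakRel (S : Finset ℕ) (x y : ℕ) : Prop := (x ∈ S → y < x) ∧ (y ∈ S → x < y)

theorem isChain_peakRel {n : ℕ} {S : Finset ℕ} {p : List ℕ} (hp : p.Nodup) (hp0 : p ≠ [])
    (hpn : ∀ x ∈ p, x ≤ n) (hpin : pin p = ↑S) :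
    List.IsChain (PeakRel (insert (n + 1) S)) ((n + 1) :: p ++ [n + 1]) := by
  have hnp : n + 1 ∉ p := fun h => by have := hpn _ h; omega
  have hnod : ((n + 1) :: p).Nodup := List.nodup_cons.2 ⟨hnp, hp⟩
  have hnod' : (p ++ [n + 1]).Nodup := by
    rw [← List.concat_eq_append, List.nodup_concat]
    exact ⟨hnp, hp⟩
  rw [List.isChain_iff_forall_rel_of_append_cons_cons]
  intro x y u v huv
  have hxy : [x, y] <:+: (n + 1) :: p ++ [n + 1] := ⟨u, v, by simpa using huv.symm⟩
  have hne := ne_of_infix_closed hnod hp0 hxy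
  have hle : ∀ z, z ∈ (n + 1) :: p ++ [n + 1] → z ≤ n + 1 := by
    intro z hz
    simp only [List.cons_append, List.mem_cons, List.mem_append, List.not_mem_nil, or_false] at hz
    rcases hz with rfl | hz | rfl
    · exact le_rfl
    · exact (hpn z hz).trans (by omega)
    · exact le_rfl
  have hx := hle x (hxy.subset (by simp))
  have hy := hle y (hxy.subset (by simp))
  have hS : ∀ z ∈ S, ∃ a b, [a, z, b] <:+: p ∧ a < z ∧ b < z := by
    intro z hz
    have : z ∈ pin p := by rw [hpin]; exact hz
    exact this
  constructor
  · intro hxS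
    by_cases hxn : x = n + 1
    · omega
    obtain ⟨a, b, h, -, hb⟩ := hS x ((Finset.mem_insert.1 hxS).resolve_left hxn)
    have h1 : [x, y] <:+: p ++ [n + 1] := by
      rw [List.cons_append, List.infix_cons_iff] at hxy
      refine hxy.resolve_left fun h => ?_
      rw [List.cons_prefix_cons] at h
      exact hxn h.1
    have h2 : [x, b] <:+: p ++ [n + 1] :=
      (List.IsInfix.trans ⟨[a], [], rfl⟩ h).trans (List.infix_append [] p [n + 1])
    rwa [succ_unique hnod' h1 h2]
  · intro hyS
    by_cases hyn : y = n + 1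
    · omega
    obtain ⟨a, b, h, ha, -⟩ := hS y ((Finset.mem_insert.1 hyS).resolve_left hyn)
    have h1 : [x, y] <:+: (n + 1) :: p := by
      rw [List.infix_concat_iff] at hxy
      refine hxy.resolve_left fun h => ?_
      obtain ⟨w, hw⟩ := h
      have h' : (w ++ [x]) ++ [y] = ((n + 1) :: p) ++ [n + 1] := by simpa using hw
      exact hyn (by simpa using (List.append_inj' h' rfl).2)
    have h2 : [a, y] <:+: (n + 1) :: p :=
      (List.IsInfix.trans ⟨[], [b], rfl⟩ h).trans (List.suffix_cons _ p).isInfix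
    rwa [pred_unique hnod h1 h2]

/-- The gap is nonempty, since two adjacent elements of `S` would each have to exceed the other. Its
first letter is below `x` and its last letter below `y`. -/
theorem exists_lt_of_isChain_peakRel {S : Finset ℕ} {x y : ℕ} {g : List ℕ}
    (h : List.IsChain (PeakRel S) (x :: g ++ [y])) (hx : x ∈ S) (hy : y ∈ S) :
    (∃ v ∈ g, v < x) ∧ ∃ v ∈ g, v < y := by
  cases g with
  | nil =>
    simp only [List.cons_append, List.nil_append, List.isChain_cons_cons] at h
    have h1 := h.1.1 hx
    have h2 := h.1.2 hy
    omega
  | cons a g =>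
    refine ⟨⟨a, by simp, ?_⟩, ?_⟩
    · simp only [List.cons_append, List.isChain_cons_cons] at h
      exact h.1.1 hx
    · obtain ⟨q, c, hq⟩ := (List.eq_nil_or_concat (a :: g)).resolve_left (by simp)
      rw [hq] at h ⊢
      refine ⟨c, by simp, ?_⟩
      have h' : List.IsChain (PeakRel S) ((x :: q) ++ c :: [y]) := by simpa using h
      have := (List.isChain_split.1 h').2
      simp only [List.isChain_cons_cons] at this
      exact this.1.2 hy

/-- Induction along the pinnacles, splitting `p` at the first one. Each gap whose dale has rank at
most `r` contributes at least one non-pinnacle below `s_r`, and the gaps occupy disjoint positions.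
The left end `a` varies in the induction. -/
theorem countP_dales_le {n : ℕ} {S : Finset ℕ} (hS : S ⊆ Finset.Icc 1 n) {r : ℕ}
    (hr : r ≤ S.card + 1) {t : List ℕ} {a b : ℕ} {p : List ℕ}
    (ha : a ≤ S.card + 1) (hb : b ≤ S.card + 1) (ht : ∀ x ∈ t, x ≤ S.card + 1)
    (haS : s n S a ∈ insert (n + 1) S) (hbS : s n S b ∈ insert (n + 1) S)
    (hc : List.IsChain (PeakRel (insert (n + 1) S)) (s n S a :: p ++ [s n S b]))
    (hf : p.filter (fun x => x ∈ S) = t.map (s n S)) :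
    (dales (a :: t ++ [b])).countP (fun e => rank e ≤ r) ≤
      p.countP (fun v => v < s n S r ∧ v ∉ S) := by
  have hmono : ∀ {i j : ℕ}, i ≤ S.card + 1 → j ≤ S.card + 1 → i ≤ j → s n S i ≤ s n S j :=
    fun hi hj hij => (strictMonoOn_s hS).monotoneOn (Set.mem_Iic.2 hi) (Set.mem_Iic.2 hj) hij
  have hgap : ∀ {a b : ℕ} {g : List ℕ}, a ≤ S.card + 1 → b ≤ S.card + 1 →
      s n S a ∈ insert (n + 1) S → s n S b ∈ insert (n + 1) S →
      List.IsChain (PeakRel (insert (n + 1) S)) (s n S a :: g ++ [s n S b]) →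
      (∀ x ∈ g, x ∉ S) → [pairDale a b].countP (fun e => rank e ≤ r) ≤
        g.countP (fun v => v < s n S r ∧ v ∉ S) := by
    intro a b g ha hb haS hbS hc hg
    by_cases hrk : rank (pairDale a b) ≤ r
    · simp only [List.countP_cons, List.countP_nil, hrk, decide_true, if_true, zero_add]
      rw [Nat.succ_le_iff, List.countP_pos_iff]
      obtain ⟨⟨v, hv, hva⟩, w, hw, hwb⟩ := exists_lt_of_isChain_peakRel hc haS hbS
      unfold pairDale at hrk
      split_ifs at hrk with hab
      · exact ⟨v, hv, by simpa using ⟨hva.trans_le (hmono ha hr hrk), hg v hv⟩⟩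
      · exact ⟨w, hw, by simpa using ⟨hwb.trans_le (hmono hb hr hrk), hg w hw⟩⟩
    · simp [hrk]
  induction t generalizing a p with
  | nil =>
    simp only [List.map_nil, List.filter_eq_nil_iff, decide_eq_true_eq] at hf
    simpa using hgap ha hb haS hbS hc hf
  | cons y t ih =>
    rw [List.map_cons, List.filter_eq_cons_iff] at hf
    obtain ⟨g, q, rfl, hg, hyS, hq⟩ := hf
    simp only [decide_eq_true_eq] at hg hyS
    have hc' : List.IsChain (PeakRel (insert (n + 1) S))
        ((s n S a :: g) ++ s n S y :: (q ++ [s n S b])) := by simpa using hc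
    rw [List.isChain_split] at hc'
    have hyS' : s n S y ∈ insert (n + 1) S := Finset.mem_insert_of_mem hyS
    have h1 := hgap ha (ht y (by simp)) haS hyS' hc'.1 hg
    have h2 := ih (ht y (by simp)) (fun x hx => ht x (by simp [hx])) hyS' hc'.2 hq
    rw [List.countP_append, List.countP_cons]
    have h3 : dales (a :: y :: t ++ [b]) = [pairDale a y] ++ dales (y :: t ++ [b]) := by simp
    rw [h3, List.countP_append]
    omega

theorem card_filter_rank_le {n : ℕ} {S : Finset ℕ} (hS : S ⊆ Finset.Icc 1 n)
    {t p : List ℕ} (ht : IsOrdering (Finset.Icc 1 S.card) t) (hp : IsOrdering (Finset.Icc 1 n) p)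
    (hp0 : p ≠ []) (hpin : pin p = ↑S) (hf : p.filter (fun x => x ∈ S) = t.map (s n S))
    {r : ℕ} (hr : r ≤ S.card + 1) :
    ((dales ((S.card + 1) :: t ++ [S.card + 1])).toFinset.filter (fun e => rank e ≤ r)).card ≤
      (lowers S (s n S r)).card := by
  have hc := isChain_peakRel hp.1 hp0 (fun x hx => (Finset.mem_Icc.1 (hp.mem_iff.1 hx)).2) hpin
  have htop : s n S (S.card + 1) ∈ insert (n + 1) S := by simp [s_card_add_one]
  have := countP_dales_le hS hr (a := S.card + 1) (b := S.card + 1) (t := t) (p := p) le_rfl le_rfl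
    (fun x hx => by have := Finset.mem_Icc.1 (ht.mem_iff.1 hx); omega) htop htop
    (by simpa [s_card_add_one] using hc) hf
  refine le_trans ?_ (this.trans ?_)
  · rw [List.countP_eq_length_filter]
    refine le_trans (le_of_eq (congrArg Finset.card ?_)) (List.toFinset_card_le _)
    ext e
    simp
  · rw [List.countP_eq_length_filter, ← List.toFinset_card_of_nodup (hp.1.filter _)]
    apply Finset.card_le_card
    intro v hv
    simp only [List.mem_toFinset, List.mem_filter, decide_eq_true_eq, hp.mem_iff,
      Finset.mem_Icc] at hv
    exact mem_lowers.2 ⟨⟨hv.1.1, hv.2.1⟩, hv.2.2⟩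

/-! ### Sufficiency: filling the gaps by Hall's theorem -/

/-- The word `v₀ f(t₁) v₁ f(t₂) v₂ ⋯` in which each dale of the closed word `a t b` is filled with
a single entry given by `v`. -/
def fillDales (f : ℕ → ℕ) (v : Dale → ℕ) (b : ℕ) : ℕ → List ℕ → List ℕ
  | a, [] => [v (pairDale a b)]
  | a, y :: t => v (pairDale a y) :: f y :: fillDales f v b y t

theorem fillDales_perm (f : ℕ → ℕ) (v : Dale → ℕ) (b a : ℕ) (t : List ℕ) :
    (fillDales f v b a t).Perm (t.map f ++ (dales (a :: t ++ [b])).map v) := by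
  induction t generalizing a with
  | nil => simp [fillDales]
  | cons y t ih =>
    simp only [fillDales, List.map_cons, List.cons_append, dales_cons_cons]
    refine (List.Perm.swap _ _ _).trans (List.Perm.cons _ ?_)
    exact ((ih y).cons _).trans List.perm_middle.symm

theorem filter_fillDales {S : Finset ℕ} {f : ℕ → ℕ} {v : Dale → ℕ} {b a : ℕ} {t : List ℕ}
    (hf : ∀ x ∈ t, f x ∈ S) (hv : ∀ e ∈ dales (a :: t ++ [b]), v e ∉ S) :
    (fillDales f v b a t).filter (fun x => x ∈ S) = t.map f := by
  induction t generalizing a with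
  | nil => simpa [fillDales] using hv
  | cons y t ih =>
    simp only [List.cons_append, dales_cons_cons, List.forall_mem_cons] at hv hf
    simp [fillDales, hv.1, hf.1, ih hf.2 hv.2]

/-- Adjacent entries `x`, `y` of a word are compatible with the pinnacle set being `S`, where every
entry outside `S` is preceded by a larger one. -/
def ShapeRel (S : Finset ℕ) (x y : ℕ) : Prop := PeakRel S x y ∧ (y ∉ S → y < x)

theorem isChain_fillDales {S : Finset ℕ} {f : ℕ → ℕ} {v : Dale → ℕ} {b a : ℕ} {t : List ℕ}
    (hfa : f a ∈ S) (hfb : f b ∈ S) (hf : ∀ x ∈ t, f x ∈ S)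
    (hv : ∀ x y, [x, y] <:+: a :: t ++ [b] → v (pairDale x y) ∉ S ∧ v (pairDale x y) < f x ∧
      v (pairDale x y) < f y) :
    List.IsChain (ShapeRel S) (f a :: fillDales f v b a t ++ [f b]) := by
  induction t generalizing a with
  | nil =>
    have := hv a b ⟨[], [], by simp⟩
    simp [fillDales, ShapeRel, PeakRel, this, hfa, hfb]
  | cons y t ih =>
    have h := hv a y ⟨[], t ++ [b], by simp⟩
    rw [List.forall_mem_cons] at hf
    have := ih hf.1 hf.2 (fun x z hxz => hv x z (List.infix_cons_iff.2 (Or.inr hxz)))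
    simp only [fillDales, List.cons_append, List.isChain_cons_cons] at this ⊢
    exact ⟨⟨⟨fun _ => h.2.1, fun h' => absurd h' h.1⟩, fun _ => h.2.1⟩,
      ⟨⟨fun h' => absurd h' h.1, fun _ => h.2.2⟩, fun h' => absurd hf.1 h'⟩, this⟩

/-- A letter outside `S` has a larger predecessor, so it is no pinnacle. A letter of `S` exceeds
both neighbours in the closed word, so neither is `n + 1` and both lie in `p`. -/
theorem pin_eq_of_isChain_shapeRel {n : ℕ} {S : Finset ℕ} {p : List ℕ}
    (hp : IsOrdering (Finset.Icc 1 n) p) (hS : S ⊆ Finset.Icc 1 n)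
    (hc : List.IsChain (ShapeRel (insert (n + 1) S)) ((n + 1) :: p ++ [n + 1])) :
    pin p = ↑S := by
  have hlt : ∀ x ∈ p, x < n + 1 := fun x hx => by
    have := Finset.mem_Icc.1 (hp.mem_iff.1 hx); omega
  ext y
  constructor
  · rintro ⟨x, z, h, hxy, -⟩
    have hy := hlt y (h.subset (by simp))
    obtain ⟨u, v, rfl⟩ := h
    by_contra hyS
    have h' : (n + 1) :: (u ++ [x, y, z] ++ v) ++ [n + 1] =
      ((n + 1) :: u) ++ x :: y :: (z :: v ++ [n + 1]) := by simp
    have := (List.isChain_iff_forall_rel_of_append_cons_cons.1 hc h').2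
      (by simpa [hy.ne] using hyS)
    omega
  · intro hyS
    have hyS' : y ∈ insert (n + 1) S := Finset.mem_insert_of_mem hyS
    have hyp : y ∈ p := hp.mem_iff.2 (hS hyS)
    have hy := hlt y hyp
    obtain ⟨u, v, rfl⟩ := List.append_of_mem hyp
    obtain ⟨q, x, hq⟩ := (List.eq_nil_or_concat ((n + 1) :: u)).resolve_left (by simp)
    obtain ⟨z, q', hq'⟩ : ∃ z q', v ++ [n + 1] = z :: q' :=
      List.exists_cons_of_ne_nil (by simp)
    have e : (n + 1) :: (u ++ y :: v) ++ [n + 1] = ((n + 1) :: u) ++ y :: (v ++ [n + 1]) := by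
      simp
    rw [hq, hq'] at e
    have hrel := @((List.isChain_iff_forall_rel_of_append_cons_cons).1 hc)
    have h1 : ShapeRel _ x y := hrel (l₁ := q) (l₂ := z :: q') (by rw [e]; simp)
    have h2 : ShapeRel _ y z := hrel (l₁ := q ++ [x]) (l₂ := q') (by rw [e]; simp)
    have hxy := h1.1.2 hyS'
    have hzy := h2.1.1 hyS'
    exact ⟨x, z, infix_triple hp.1
      (infix_of_infix_closed ⟨q, z :: q', by rw [e]; simp⟩ (by omega) (by omega))
      (infix_of_infix_closed ⟨q ++ [x], q', by rw [e]; simp⟩ (by omega) (by omega)), hxy, hzy⟩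

/-- For a family `X` with largest rank `r`, all of `X` has rank at most `r`, and the union of the
candidate sets contains the one at `r`. Hall's condition therefore follows from the counts by rank.
-/
theorem exists_injOn_lowers {S : Finset ℕ} {B : Finset Dale} {N : ℕ} {f : ℕ → ℕ}
    (hB : ∀ e ∈ B, rank e ≤ N)
    (h : ∀ r ≤ N, (B.filter (fun e => rank e ≤ r)).card ≤ (lowers S (f r)).card) :
    ∃ v : Dale → ℕ, Set.InjOn v B ∧ ∀ e ∈ B, v e ∈ lowers S (f (rank e)) := by
  classical
  obtain ⟨g, hg, hgm⟩ := (Finset.all_card_le_biUnion_card_iff_exists_injective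
    (fun e : {e // e ∈ B} => lowers S (f (rank e.1)))).1 (by
      intro X
      rcases X.eq_empty_or_nonempty with rfl | hX
      · simp
      obtain ⟨m, hm, hmax⟩ := X.exists_max_image (fun e => rank e.1) hX
      refine le_trans ?_ ((h (rank m.1) (hB _ m.2)).trans
        (Finset.card_le_card (Finset.subset_biUnion_of_mem
          (fun e : {e // e ∈ B} => lowers S (f (rank e.1))) hm)))
      rw [← Finset.card_image_of_injective X Subtype.val_injective]
      apply Finset.card_le_card
      intro e he
      obtain ⟨e', he', rfl⟩ := Finset.mem_image.1 he
      exact Finset.mem_filter.2 ⟨e'.2, hmax e' he'⟩)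
  refine ⟨fun e => if he : e ∈ B then g ⟨e, he⟩ else 0, ?_, ?_⟩
  · intro e he e' he' hee
    rw [Finset.mem_coe] at he he'
    simp only [he, he', dif_pos] at hee
    exact congrArg Subtype.val (hg hee)
  · intro e he
    simp only [he, dif_pos]
    exact hgm ⟨e, he⟩

theorem exists_ordering_of_card_le {n : ℕ} {S : Finset ℕ} (hS : S ⊆ Finset.Icc 1 n)
    {t : List ℕ} (ht : IsOrdering (Finset.Icc 1 S.card) t) (ht0 : t ≠ [])
    (h : ∀ r ≤ S.card + 1,
      ((dales ((S.card + 1) :: t ++ [S.card + 1])).toFinset.filter (fun e => rank e ≤ r)).card ≤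
        (lowers S (s n S r)).card) :
    ∃ p, IsOrdering (Finset.Icc 1 n) p ∧ pin p = ↑S ∧
      p.filter (fun x => x ∈ S) = t.map (s n S) := by
  set d := S.card with hd
  set T := (d + 1) :: t ++ [d + 1] with hT
  have hmono : ∀ {i j : ℕ}, i ≤ d + 1 → j ≤ d + 1 → i ≤ j → s n S i ≤ s n S j :=
    fun hi hj hij => (strictMonoOn_s hS).monotoneOn (Set.mem_Iic.2 hi) (Set.mem_Iic.2 hj) hij
  have htop : s n S (d + 1) = n + 1 := s_card_add_one n S
  have hmemT : ∀ x ∈ T, x ≤ d + 1 := by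
    intro x hx
    simp only [hT, List.cons_append, List.mem_cons, List.mem_append, List.not_mem_nil,
      or_false] at hx
    rcases hx with rfl | hx | rfl
    · exact le_rfl
    · have := Finset.mem_Icc.1 (ht.mem_iff.1 hx); omega
    · exact le_rfl
  have hrank : ∀ x y, rank (pairDale x y) ≤ x ∧ rank (pairDale x y) ≤ y := by
    intro x y
    unfold pairDale
    split_ifs with hxy
    · exact ⟨le_rfl, hxy.le⟩
    · exact ⟨not_lt.1 hxy, le_rfl⟩
  have hrankT : ∀ e ∈ (dales T).toFinset, rank e ≤ d + 1 := by
    intro e he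
    obtain ⟨x, y, hxy, rfl⟩ := mem_dales_iff.1 (List.mem_toFinset.1 he)
    exact (hrank x y).1.trans (hmemT x (hxy.subset (by simp)))
  obtain ⟨v, hvinj, hv⟩ := exists_injOn_lowers (S := S) hrankT h
  have hvT : ∀ x y, [x, y] <:+: T → v (pairDale x y) ∉ S ∧ 1 ≤ v (pairDale x y) ∧
      v (pairDale x y) < s n S x ∧ v (pairDale x y) < s n S y ∧ v (pairDale x y) < n + 1 := by
    intro x y hxy
    have hx := hmemT x (hxy.subset (by simp))
    have hy := hmemT y (hxy.subset (by simp))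
    have hr := hrank x y
    have := mem_lowers.1 (hv _ (List.mem_toFinset.2 (mem_dales_iff.2 ⟨x, y, hxy, rfl⟩)))
    refine ⟨this.2, this.1.1, this.1.2.trans_le (hmono (hr.1.trans hx) hx hr.1),
      this.1.2.trans_le (hmono (hr.1.trans hx) hy hr.2), ?_⟩
    rw [← htop]
    exact this.1.2.trans_le (hmono (hr.1.trans hx) le_rfl (hr.1.trans hx))
  have hordS := isOrdering_map_s hS ht
  obtain ⟨y, t', rfl⟩ := List.exists_cons_of_ne_nil ht0
  have hsS : ∀ x ∈ y :: t', s n S x ∈ S := fun x hx =>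
    hordS.mem_iff.1 (List.mem_map_of_mem hx)
  have hsS' : ∀ x ∈ y :: t', s n S x ∈ insert (n + 1) S := fun x hx =>
    Finset.mem_insert_of_mem (hsS x hx)
  have htopS : s n S (d + 1) ∈ insert (n + 1) S := by simp [htop]
  set V := (dales T).toFinset.image v with hV
  have hVmem : ∀ x ∈ V, x ∉ S ∧ 1 ≤ x ∧ x < n + 1 := by
    intro x hx
    obtain ⟨e, he, rfl⟩ := Finset.mem_image.1 hx
    obtain ⟨x, z, hxz, rfl⟩ := mem_dales_iff.1 (List.mem_toFinset.1 he)
    have := hvT x z hxz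
    exact ⟨this.1, this.2.1, this.2.2.2.2⟩
  -- The non-pinnacles that Hall's selection leaves unused.
  set U := (Finset.Icc 1 n \ S) \ V with hU
  set v₀ := v (pairDale (d + 1) y) with hv₀
  have hTy : [d + 1, y] <:+: T := ⟨[], t' ++ [d + 1], by simp [hT]⟩
  have hv₀V : v₀ ∈ V := Finset.mem_image_of_mem v
    (List.mem_toFinset.2 (mem_dales_iff.2 ⟨d + 1, y, hTy, rfl⟩))
  have hv₀U : v₀ ∉ U := fun h => (Finset.mem_sdiff.1 h).2 hv₀V
  -- The first gap receives `v₀` and all of `U` in decreasing order. The run starts below `n + 1`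
  -- and ends at a letter at most `v₀`, hence below the first pinnacle `s n S y`, however large the
  -- letters of `U` are.
  set G := (insert v₀ U).sort (· ≥ ·) with hG
  have hGmem : ∀ x ∈ G, x ∉ insert (n + 1) S ∧ x < n + 1 := by
    intro x hx
    rw [hG, Finset.mem_sort, Finset.mem_insert] at hx
    have h1 : x ∉ S ∧ x < n + 1 := by
      rcases hx with rfl | hx
      · exact ⟨(hVmem _ hv₀V).1, (hVmem _ hv₀V).2.2⟩
      · simp only [hU, Finset.mem_sdiff, Finset.mem_Icc] at hx
        exact ⟨hx.1.2, by omega⟩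
    exact ⟨by simp [h1.1, h1.2.ne], h1.2⟩
  have hGlast : ∀ x ∈ G.getLast?, x ≤ v₀ := by
    intro x hx
    have hv₀G : v₀ ∈ G := by simp [hG]
    obtain ⟨q, hq⟩ := List.mem_getLast?_eq_getLast hx |>.elim fun h0 h1 =>
      (⟨G.dropLast, by rw [h1]; exact (List.dropLast_append_getLast h0).symm⟩ :
        ∃ q, G = q ++ [x])
    have hpw := Finset.pairwise_sort (insert v₀ U) (· ≥ ·)
    rw [← hG, hq, List.pairwise_append] at hpw
    rw [hq, List.mem_append, List.mem_singleton] at hv₀G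
    rcases hv₀G with h' | h'
    · exact hpw.2.2 _ h' x (by simp)
    · exact h'.ge
  have hchain : List.IsChain (ShapeRel (insert (n + 1) S))
      ((n + 1) :: (G ++ s n S y :: fillDales (s n S) v (d + 1) y t') ++ [n + 1]) := by
    have h1 : List.IsChain (ShapeRel (insert (n + 1) S))
        (s n S y :: fillDales (s n S) v (d + 1) y t' ++ [s n S (d + 1)]) := by
      refine isChain_fillDales (hsS' y (by simp)) htopS (fun x hx => hsS' x (by simp [hx])) ?_
      intro x z hxz
      have := hvT x z (List.infix_cons_iff.2 (Or.inr hxz))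
      exact ⟨by simp [this.1, this.2.2.2.2.ne], this.2.2.1, this.2.2.2.1⟩
    have h2 : List.IsChain (ShapeRel (insert (n + 1) S)) ((n + 1) :: G) := by
      apply List.Pairwise.isChain
      rw [List.pairwise_cons]
      refine ⟨fun x hx => ?_, ?_⟩
      · have := hGmem x hx
        exact ⟨⟨fun _ => this.2, fun h' => absurd h' this.1⟩, fun _ => this.2⟩
      · refine List.Pairwise.imp_of_mem ?_ (Finset.sortedGT_sort (insert v₀ U)).pairwise
        intro x z hx hz hxz
        exact ⟨⟨fun h' => absurd h' (hGmem x hx).1, fun h' => absurd h' (hGmem z hz).1⟩,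
          fun _ => hxz⟩
    have h3 : (n + 1) :: (G ++ s n S y :: fillDales (s n S) v (d + 1) y t') ++ [n + 1] =
        ((n + 1) :: G) ++ (s n S y :: fillDales (s n S) v (d + 1) y t' ++ [s n S (d + 1)]) := by
      simp [htop]
    rw [h3, List.isChain_append]
    refine ⟨h2, h1, ?_⟩
    intro x hx z hz
    obtain rfl : s n S y = z := by simpa using hz
    have hG0 : G ≠ [] := List.ne_nil_of_mem (a := v₀) (by simp [hG])
    rw [List.getLast?_cons_of_ne_nil hG0] at hx
    have hxG := hGmem x (List.mem_of_mem_getLast? hx)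
    have hlt := (hGlast x hx).trans_lt (hvT _ _ hTy).2.2.2.1
    exact ⟨⟨fun h' => absurd h' hxG.1, fun _ => hlt⟩, fun h' => absurd (hsS' y (by simp)) h'⟩
  have hperm : (G ++ s n S y :: fillDales (s n S) v (d + 1) y t').Perm
      (U.toList ++ ((y :: t').map (s n S) ++ (dales T).map v)) := by
    have h1 : G.Perm (v₀ :: U.toList) :=
      (Finset.sort_perm_toList _ _).trans (Finset.toList_insert hv₀U)
    have h2 : (v₀ :: U.toList ++ s n S y :: fillDales (s n S) v (d + 1) y t').Perm
        (U.toList ++ fillDales (s n S) v (d + 1) (d + 1) (y :: t')) := by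
      rw [fillDales]
      exact List.perm_middle.symm
    exact ((h1.append_right _).trans h2).trans ((fillDales_perm _ _ _ _ _).append_left _)
  have hnd : (dales T).Nodup := nodup_dales ht.1 (fun h' => by
    have := Finset.mem_Icc.1 (ht.mem_iff.1 h'); omega) (fun h' => by
    have := Finset.mem_Icc.1 (ht.mem_iff.1 h'); omega)
  have hmV : ∀ x, x ∈ (dales T).map v ↔ x ∈ V := by intro x; simp [hV]
  have hord : IsOrdering (Finset.Icc 1 n)
      (G ++ s n S y :: fillDales (s n S) v (d + 1) y t') := by
    refine ⟨hperm.nodup_iff.2 ?_, (List.toFinset_eq_of_perm _ _ hperm).trans ?_⟩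
    · rw [List.nodup_append', List.nodup_append']
      refine ⟨U.nodup_toList, ⟨hordS.1, ?_, ?_⟩, ?_⟩
      · exact (List.nodup_map_iff_inj_on hnd).2 (fun x hx z hz hxz =>
          hvinj (by simpa using hx) (by simpa using hz) hxz)
      · intro x hx hx'
        exact (hVmem x ((hmV x).1 hx')).1 (hordS.mem_iff.1 hx)
      · intro x hx hx'
        rw [Finset.mem_toList, hU, Finset.mem_sdiff, Finset.mem_sdiff] at hx
        rcases List.mem_append.1 hx' with hx' | hx'
        · exact hx.1.2 (hordS.mem_iff.1 hx')
        · exact hx.2 ((hmV x).1 hx')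
    · ext x
      rw [List.mem_toFinset, List.mem_append, List.mem_append, hmV, hordS.mem_iff,
        Finset.mem_toList, hU, Finset.mem_sdiff, Finset.mem_sdiff]
      constructor
      · rintro (hx | hx | hx)
        · exact hx.1.1
        · exact hS hx
        · have := hVmem x hx
          exact Finset.mem_Icc.2 ⟨this.2.1, by omega⟩
      · tauto
  refine ⟨_, hord, pin_eq_of_isChain_shapeRel hord hS hchain, ?_⟩
  have h1 : G.filter (fun x => x ∈ S) = [] := by
    rw [List.filter_eq_nil_iff]
    intro x hx
    simpa using fun h' => (hGmem x hx).1 (Finset.mem_insert_of_mem h')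
  rw [List.filter_append, h1, List.nil_append, List.filter_cons_of_pos
    (by simpa using hsS y (by simp)), filter_fillDales (fun x hx => hsS x (by simp [hx])),
    List.map_cons]
  intro e he
  obtain ⟨x, z, hxz, rfl⟩ := mem_dales_iff.1 he
  exact (hvT x z (List.infix_cons_iff.2 (Or.inr hxz))).1

theorem mem_admissibleOrderings_iff {n : ℕ} {S : Finset ℕ} (hS : S ⊆ Finset.Icc 1 n)
    (hS0 : S.Nonempty) {t : List ℕ} (ht : IsOrdering (Finset.Icc 1 S.card) t) :
    t.map (s n S) ∈ admissibleOrderings n S ↔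
      Fits n S (daleSet S.card (((S.card + 1) :: t : List ℕ) : Cycle ℕ)) := by
  have ht0 : t ≠ [] := by
    rintro rfl
    have := ht.mem_iff.2 (Finset.mem_Icc.2 ⟨le_rfl, hS0.card_pos⟩)
    simp at this
  have hord : IsOrdering (Finset.Icc 1 (S.card + 1)) ((S.card + 1) :: t) := by
    rw [← insert_Icc_one]
    exact ht.cons (by simp)
  rw [fits_iff_card_le hS, daleSet_coe_cons hord ht0]
  · constructor
    · rintro ⟨-, p, hp, hpin, hf⟩ r hr
      refine card_filter_rank_le hS ht hp ?_ hpin hf hr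
      rintro rfl
      obtain ⟨x, hx⟩ := hS0
      have := hp.mem_iff.2 (hS hx)
      simp at this
    · intro h
      exact ⟨isOrdering_map_s hS ht, exists_ordering_of_card_le hS ht ht0 h⟩
  · intro e he
    simp only [daleSet, Finset.mem_union, Finset.mem_image, Finset.mem_filter,
      Finset.mem_Icc] at he
    rcases he with ⟨i, hi, rfl⟩ | ⟨i, hi, rfl⟩
    · rw [rank_left]; omega
    · rw [rank_right]; omega

/-! ### Counting cycles by dale set: insertion of a new maximum -/

/-- All orderings of the finite set `A`. -/
noncomputable def orderings (A : Finset ℕ) : Finset (List ℕ) := A.toList.permutations.toFinset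

theorem mem_orderings {A : Finset ℕ} {l : List ℕ} : l ∈ orderings A ↔ IsOrdering A l := by
  simp only [orderings, List.mem_toFinset, List.mem_permutations, IsOrdering]
  constructor
  · intro h
    exact ⟨h.nodup_iff.2 A.nodup_toList, by rw [List.toFinset_eq_of_perm _ _ h, A.toList_toFinset]⟩
  · rintro ⟨h, rfl⟩
    exact (List.toFinset_toList h).symm

/-- The dales of the cycle `1 w`. -/
def rootedDales (w : List ℕ) : Finset Dale := (dales (1 :: w ++ [1])).toFinset

/-- The dale among `right a`, `left b` that is not the dale between `a` and `b`. -/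
def coDale (a b : ℕ) : Dale := if a < b then left b else right a

/-- A maximum placed between `a` and `b` replaces their dale by `right a` and `left b`. One of these
is the old dale, so the other is the only change. -/
theorem toFinset_dales_insert {M a b : ℕ} {U V : List ℕ} (ha : a < M) (hb : b < M) :
    (dales (U ++ a :: M :: b :: V)).toFinset =
      insert (coDale a b) (dales (U ++ a :: b :: V)).toFinset := by
  rw [dales_append_cons, dales_append_cons U a (b :: V)]
  simp only [dales_cons_cons, coDale, pairDale, ha, hb.not_gt, if_true, if_false]
  ext e
  split_ifs
  · simp; tauto
  · simp

theorem coDale_notMem {M a b : ℕ} {U V : List ℕ} (ha : a < M) (hb : b < M)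
    (h : (dales (U ++ a :: M :: b :: V)).Nodup) :
    coDale a b ∉ (dales (U ++ a :: b :: V)).toFinset := by
  rw [dales_append_cons] at h
  rw [dales_append_cons U a (b :: V)]
  simp only [dales_cons_cons, coDale, pairDale, ha, hb.not_gt, if_true, if_false,
    List.nodup_append', List.nodup_cons, List.mem_cons, not_or] at h ⊢
  obtain ⟨-, ⟨⟨-, h1⟩, h2, -⟩, h3⟩ := h
  rw [List.disjoint_right] at h3
  simp only [List.mem_cons, forall_eq_or_imp] at h3
  split_ifs <;> simp [left_ne_right, (left_ne_right _ _).symm, *]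

/-- Insert the letter `M` next to the letter `rank e`, on the side of the dale `e`. -/
def insertAt (M : ℕ) (e : Dale) (w : List ℕ) : List ℕ :=
  w.flatMap fun x => if x = rank e then (if (ofLex e).2 then [x, M] else [M, x]) else [x]

theorem filter_insertAt {M : ℕ} {e : Dale} {w : List ℕ} (h : M ∉ w) :
    (insertAt M e w).filter (fun x => x ≠ M) = w := by
  induction w with
  | nil => rfl
  | cons a w ih =>
    simp only [List.mem_cons, not_or] at h
    have ih' := ih h.2
    simp only [insertAt, List.flatMap_cons, List.filter_append] at ih' ⊢
    rw [ih']
    split_ifs <;> simp [Ne.symm h.1]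

theorem flatMap_eq_self {w : List ℕ} {f : ℕ → List ℕ} (h : ∀ x ∈ w, f x = [x]) :
    w.flatMap f = w := by
  induction w with
  | nil => rfl
  | cons a w ih =>
    rw [List.forall_mem_cons] at h
    simp [h.1, ih h.2]

theorem insertAt_right {M a : ℕ} {u v : List ℕ} (hu : a ∉ u) (hv : a ∉ v) :
    insertAt M (right a) (u ++ a :: v) = u ++ a :: M :: v := by
  have h : ∀ w : List ℕ, a ∉ w → insertAt M (right a) w = w := fun w hw =>
    flatMap_eq_self fun x hx => by
      rw [if_neg]; rintro rfl; exact hw hx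
  have e : insertAt M (right a) (u ++ a :: v) =
      insertAt M (right a) u ++ ([a, M] ++ insertAt M (right a) v) := by
    simp [insertAt, right, rank]
  rw [e, h u hu, h v hv]
  rfl

theorem insertAt_left {M a : ℕ} {u v : List ℕ} (hu : a ∉ u) (hv : a ∉ v) :
    insertAt M (left a) (u ++ a :: v) = u ++ M :: a :: v := by
  have h : ∀ w : List ℕ, a ∉ w → insertAt M (left a) w = w := fun w hw =>
    flatMap_eq_self fun x hx => by
      rw [if_neg]; rintro rfl; exact hw hx
  have e : insertAt M (left a) (u ++ a :: v) =
      insertAt M (left a) u ++ ([M, a] ++ insertAt M (left a) v) := by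
    simp [insertAt, left, rank]
  rw [e, h u hu, h v hv]
  rfl

theorem insert_Icc_two {m : ℕ} (hm : 1 ≤ m) :
    insert (m + 1) (Finset.Icc 2 m) = Finset.Icc 2 (m + 1) := by
  ext; simp; omega

theorem isOrdering_insert {m : ℕ} (hm : 1 ≤ m) {u v : List ℕ} :
    IsOrdering (Finset.Icc 2 (m + 1)) (u ++ (m + 1) :: v) ↔
      IsOrdering (Finset.Icc 2 m) (u ++ v) := by
  have h1 : IsOrdering (Finset.Icc 2 (m + 1)) (u ++ (m + 1) :: v) ↔
      IsOrdering (Finset.Icc 2 (m + 1)) ((m + 1) :: (u ++ v)) := by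
    have := (List.perm_middle (a := m + 1) (l₁ := u) (l₂ := v))
    simp only [IsOrdering, this.nodup_iff, List.toFinset_eq_of_perm _ _ this]
  have h2 : m + 1 ∉ Finset.Icc 2 m := by simp
  rw [h1, ← insert_Icc_two hm]
  have := isOrdering_cons_iff (A := Finset.Icc 2 m) (x := m + 1) (l := u ++ v)
  tauto

theorem nodup_dales_rooted {m : ℕ} {w : List ℕ} (h : IsOrdering (Finset.Icc 2 m) w) :
    (dales (1 :: w ++ [1])).Nodup := by
  have : 1 ∉ w := fun h' => by simpa using h.mem_iff.1 h'
  exact nodup_dales h.1 this this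

theorem nodup_rooted {m : ℕ} {w : List ℕ} (h : IsOrdering (Finset.Icc 2 m) w) :
    (1 :: w).Nodup :=
  List.nodup_cons.2 ⟨fun h' => by simpa using h.mem_iff.1 h', h.1⟩

theorem ne_nil_of_isOrdering {m : ℕ} (hm : 2 ≤ m) {w : List ℕ}
    (h : IsOrdering (Finset.Icc 2 m) w) : w ≠ [] := by
  rintro rfl
  simpa using h.mem_iff.2 (Finset.mem_Icc.2 ⟨le_rfl, hm⟩)

theorem mem_rooted {m : ℕ} (hm : 2 ≤ m) {w : List ℕ} (h : IsOrdering (Finset.Icc 2 m) w) {x : ℕ}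
    (hx : x ∈ 1 :: w ++ [1]) : 1 ≤ x ∧ x ≤ m := by
  simp only [List.cons_append, List.mem_cons, List.mem_append, List.not_mem_nil, or_false,
    h.mem_iff, Finset.mem_Icc] at hx
  omega

theorem rank_lt_of_mem_rootedDales {m : ℕ} (hm : 2 ≤ m) {w : List ℕ}
    (h : IsOrdering (Finset.Icc 2 m) w) {e : Dale} (he : e ∈ rootedDales w) :
    1 ≤ rank e ∧ rank e < m := by
  obtain ⟨x, y, hxy, rfl⟩ := mem_dales_iff.1 (List.mem_toFinset.1 he)
  have hne := ne_of_infix_closed (nodup_rooted h) (ne_nil_of_isOrdering hm h) hxy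
  have hx := mem_rooted hm h (hxy.subset (show x ∈ [x, y] by simp))
  have hy := mem_rooted hm h (hxy.subset (show y ∈ [x, y] by simp))
  unfold pairDale
  split_ifs
  · rw [rank_right]; omega
  · rw [rank_left]; omega

theorem rank_one_subset_rootedDales {m : ℕ} (hm : 2 ≤ m) {w : List ℕ}
    (h : IsOrdering (Finset.Icc 2 m) w) : {left 1, right 1} ⊆ rootedDales w := by
  have hw := ne_nil_of_isOrdering hm h
  have h1 : ∀ x ∈ w, 1 < x := fun x hx => (Finset.mem_Icc.1 (h.mem_iff.1 hx)).1
  intro e he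
  rw [Finset.mem_insert, Finset.mem_singleton] at he
  rw [rootedDales, List.mem_toFinset]
  rcases he with rfl | rfl
  · obtain ⟨q, c, rfl⟩ := (List.eq_nil_or_concat w).resolve_left hw
    exact left_mem_dales_iff.2 ⟨c, ⟨1 :: q, [], by simp⟩, (h1 c (by simp)).le⟩
  · obtain ⟨c, q, rfl⟩ := List.exists_cons_of_ne_nil hw
    exact right_mem_dales_iff.2 ⟨c, ⟨[], q ++ [1], by simp⟩, h1 c (by simp)⟩

theorem rootedDales_insert {m a b : ℕ} (hm : 2 ≤ m) {u v U V : List ℕ}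
    (h : IsOrdering (Finset.Icc 2 m) (u ++ v)) (hu : 1 :: u = U ++ [a]) (hv : v ++ [1] = b :: V) :
    a ≠ b ∧ 1 ≤ a ∧ 1 ≤ b ∧
    rootedDales (u ++ (m + 1) :: v) = insert (coDale a b) (rootedDales (u ++ v)) ∧
      coDale a b ∉ rootedDales (u ++ v) ∧ pairDale a b ∈ rootedDales (u ++ v) := by
  have e1 : 1 :: (u ++ v) ++ [1] = U ++ a :: b :: V := by
    rw [← List.cons_append, hu, List.append_assoc, hv]; simp
  have e2 : 1 :: (u ++ (m + 1) :: v) ++ [1] = U ++ a :: (m + 1) :: b :: V := by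
    rw [← List.cons_append, hu, List.append_assoc, List.cons_append, hv]; simp
  have h' := nodup_dales_rooted ((isOrdering_insert (by omega)).2 h)
  have ha := mem_rooted hm h (x := a) (by rw [e1]; simp)
  have hb := mem_rooted hm h (x := b) (by rw [e1]; simp)
  have hab : [a, b] <:+: 1 :: (u ++ v) ++ [1] := ⟨U, V, by rw [e1]; simp⟩
  refine ⟨ne_of_infix_closed (nodup_rooted h) (ne_nil_of_isOrdering hm h) hab, ha.1, hb.1,
    ?_, ?_, List.mem_toFinset.2 (mem_dales_iff.2 ⟨a, b, hab, rfl⟩)⟩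
  · rw [rootedDales, rootedDales, e1, e2, toFinset_dales_insert (by omega) (by omega)]
  · rw [e2] at h'
    rw [rootedDales, e1]
    exact coDale_notMem (by omega) (by omega) h'

/-- The number of cyclic orderings of `1, …, m` with set of dales `D`. -/
noncomputable def dalesCount (m : ℕ) (D : Finset Dale) : ℕ :=
  ((orderings (Finset.Icc 2 m)).filter (fun w => rootedDales w = D)).card

/-- If `right a` is missing, the letter after `a` is not larger than `a`, so inserting the maximum
there adds exactly `right a`; symmetrically for `left a`. -/
theorem insertAt_spec {m : ℕ} (hm : 2 ≤ m) {w : List ℕ} (h : IsOrdering (Finset.Icc 2 m) w)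
    {e : Dale} (he : e ∉ rootedDales w) (h1 : 1 ≤ rank e) (h2 : rank e ≤ m) :
    IsOrdering (Finset.Icc 2 (m + 1)) (insertAt (m + 1) e w) ∧
      rootedDales (insertAt (m + 1) e w) = insert e (rootedDales w) := by
  have h0 := rank_one_subset_rootedDales hm h
  -- Both dales of rank 1 are always present, so the insertion never takes place next to the root 1,
  -- which is not a letter of `w`.
  have hr : rank e ≠ 1 := by
    intro hr
    apply he
    apply h0
    rcases eq_left_or_right e with ⟨i, rfl⟩ | ⟨i, rfl⟩ <;> simp_all
  have hmem : rank e ∈ w := h.mem_iff.2 (Finset.mem_Icc.2 ⟨by omega, h2⟩)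
  obtain ⟨u, v, rfl⟩ := List.append_of_mem hmem
  have hnd := h.1
  rw [List.nodup_append', List.nodup_cons] at hnd
  have hu : rank e ∉ u := fun h' => hnd.2.2 h' (by simp)
  have hv : rank e ∉ v := hnd.2.1.1
  rcases eq_left_or_right e with ⟨a, rfl⟩ | ⟨a, rfl⟩
  · rw [rank_left] at *
    rw [insertAt_left hu hv]
    refine ⟨(isOrdering_insert (by omega)).2 h, ?_⟩
    obtain ⟨U, c, hU⟩ := (List.eq_nil_or_concat (1 :: u)).resolve_left (by simp)
    rw [List.concat_eq_append] at hU
    obtain ⟨hne, -, -, hins, -, hpair⟩ := rootedDales_insert hm h hU (b := a) (V := v ++ [1]) rfl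
    rw [hins]
    congr 1
    unfold coDale
    rw [if_pos]
    by_contra hlt
    apply he
    rwa [pairDale, if_neg hlt] at hpair
  · rw [rank_right] at *
    rw [insertAt_right hu hv]
    have e1 : u ++ a :: (m + 1) :: v = (u ++ [a]) ++ (m + 1) :: v := by simp
    have e2 : u ++ a :: v = (u ++ [a]) ++ v := by simp
    rw [e2] at h he
    rw [e1, e2]
    refine ⟨(isOrdering_insert (by omega)).2 h, ?_⟩
    obtain ⟨b, V, hV⟩ := List.exists_cons_of_ne_nil (show v ++ [1] ≠ [] by simp)
    obtain ⟨hne, -, -, hins, -, hpair⟩ := rootedDales_insert hm h (a := a) (U := 1 :: u) rfl hV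
    rw [hins]
    congr 1
    unfold coDale
    rw [if_neg]
    intro hlt
    apply he
    rwa [pairDale, if_pos hlt] at hpair

theorem exists_insertAt_eq {m : ℕ} (hm : 2 ≤ m) {w : List ℕ}
    (h : IsOrdering (Finset.Icc 2 (m + 1)) w) :
    ∃ e w', IsOrdering (Finset.Icc 2 m) w' ∧ e ∉ rootedDales w' ∧
      rootedDales w = insert e (rootedDales w') ∧ insertAt (m + 1) e w' = w := by
  obtain ⟨u, v, rfl⟩ := List.append_of_mem
    (h.mem_iff.2 (show m + 1 ∈ Finset.Icc 2 (m + 1) by simp; omega))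
  have h' := (isOrdering_insert (by omega)).1 h
  obtain ⟨U, a, hU⟩ := (List.eq_nil_or_concat (1 :: u)).resolve_left (by simp)
  rw [List.concat_eq_append] at hU
  obtain ⟨b, V, hV⟩ := List.exists_cons_of_ne_nil (show v ++ [1] ≠ [] by simp)
  obtain ⟨hne, ha, hb, hins, hnot, -⟩ := rootedDales_insert hm h' hU hV
  refine ⟨coDale a b, u ++ v, h', hnot, hins, ?_⟩
  have hnd := h'.1
  unfold coDale
  split_ifs with hab
  · cases v with
    | nil =>
      simp only [List.nil_append, List.cons.injEq] at hV
      omega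
    | cons b' v =>
      simp only [List.cons_append, List.cons.injEq] at hV
      obtain ⟨rfl, -⟩ := hV
      rw [List.nodup_append', List.nodup_cons] at hnd
      exact insertAt_left (fun h' => hnd.2.2 h' (by simp)) hnd.2.1.1
  · rcases List.eq_nil_or_concat u with rfl | ⟨u, a', rfl⟩
    · have : a = 1 := by
        have := (List.append_inj' (show [] ++ [1] = U ++ [a] from hU) rfl).2
        simpa using this.symm
      omega
    · obtain rfl : a' = a := by
        have := (List.append_inj' (show (1 :: u) ++ [a'] = U ++ [a] by simpa using hU) rfl).2
        simpa using this
      rw [List.concat_eq_append, List.append_assoc, List.singleton_append] at hnd ⊢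
      rw [List.nodup_append', List.nodup_cons] at hnd
      rw [insertAt_right (fun h' => hnd.2.2 h' (by simp)) hnd.2.1.1]
      simp

/-- Inserting the maximum is a bijection from pairs `(e, w)` with `e ∈ D` and dale set `D.erase e`
for `w`. Deleting the maximum recovers `w`, and `e` is then the only element of `D` that is not a
dale of `w`. -/
theorem dalesCount_succ {m : ℕ} (hm : 2 ≤ m) {D : Finset Dale}
    (hD : ∀ e ∈ D, 1 ≤ rank e ∧ rank e ≤ m) :
    dalesCount (m + 1) D = ∑ e ∈ D, dalesCount m (D.erase e) := by
  unfold dalesCount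
  rw [← Finset.card_sigma]
  symm
  refine Finset.card_bij (fun x _ => insertAt (m + 1) x.1 x.2) ?_ ?_ ?_
  · rintro ⟨e, w⟩ hx
    simp only [Finset.mem_sigma, Finset.mem_filter, mem_orderings] at hx ⊢
    obtain ⟨he, hw, hwe⟩ := hx
    have := insertAt_spec hm hw (e := e) (by rw [hwe]; simp) (hD e he).1 (hD e he).2
    exact ⟨this.1, by rw [this.2, hwe, Finset.insert_erase he]⟩
  · rintro ⟨e, w⟩ hx ⟨e', w'⟩ hx' heq
    simp only [Finset.mem_sigma, Finset.mem_filter, mem_orderings] at hx hx' heq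
    obtain ⟨he, hw, hwe⟩ := hx
    obtain ⟨he', hw', hwe'⟩ := hx'
    have hM : ∀ {w}, IsOrdering (Finset.Icc 2 m) w → m + 1 ∉ w := fun hw h => by
      simpa using hw.mem_iff.1 h
    have hww : w = w' := by
      rw [← filter_insertAt (e := e) (hM hw), heq, filter_insertAt (hM hw')]
    subst hww
    have hee : e = e' := by
      by_contra hne
      have : e' ∈ D.erase e' := by
        rw [← hwe', hwe]; exact Finset.mem_erase.2 ⟨Ne.symm hne, he'⟩
      simp at this
    rw [hee]
  · intro w hw
    simp only [Finset.mem_filter, mem_orderings] at hw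
    obtain ⟨e, w', hw', he, hins, rfl⟩ := exists_insertAt_eq hm hw.1
    refine ⟨⟨e, w'⟩, ?_, rfl⟩
    simp only [Finset.mem_sigma, Finset.mem_filter, mem_orderings]
    rw [← hw.2, hins]
    exact ⟨Finset.mem_insert_self _ _, hw', (Finset.erase_insert he).symm⟩

/-! ### The product formula -/

/-- The product `∏ (c + j - r_j)` over the positions `j` of a list of dales of ranks `r_j`. -/
def slotProd : ℤ → List Dale → ℤ
  | _, [] => 1
  | c, e :: l => (c - rank e) * slotProd (c + 1) l

theorem slotProd_eq_prod (c : ℤ) (l : List Dale) :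
    slotProd c l = ∏ j ∈ Finset.range l.length, (c + j - rank (l.getD j (left 0))) := by
  induction l generalizing c with
  | nil => simp [slotProd]
  | cons e l ih =>
    rw [List.length_cons, Finset.prod_range_succ', slotProd, ih, mul_comm]
    congr 1
    · refine Finset.prod_congr rfl fun j _ => ?_
      rw [List.getD_cons_succ]
      push_cast
      ring
    · simp

/-- Erasing position `k` lowers the offset of all later factors by one. With `P k` the product using
offset `c` before `k` and `c - 1` from `k` on, the erased product is `P (k + 1) - P k`, so the sum
telescopes. -/
theorem sum_slotProd_erase (c : ℤ) {l : List Dale} (hl : l.Nodup) :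
    (l.map fun e => slotProd c (l.erase e)).sum = slotProd c l - slotProd (c - 1) l := by
  induction l generalizing c with
  | nil => simp [slotProd]
  | cons x l ih =>
    rw [List.nodup_cons] at hl
    have h : l.map (fun e => slotProd c ((x :: l).erase e)) =
        l.map (fun e => (c - rank x) * slotProd (c + 1) (l.erase e)) := by
      refine List.map_congr_left fun e he => ?_
      rw [List.erase_cons_tail (by simpa using fun h : x = e => hl.1 (h ▸ he)), slotProd]
    rw [List.map_cons, List.sum_cons, h, List.sum_map_mul_left, ih (c + 1) hl.2,
      List.erase_cons_head, slotProd, slotProd, add_sub_cancel_right, sub_add_cancel]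
    ring

/-- A discrete intermediate value argument: `r_j - (c + j)` starts nonnegative, ends nonpositive and
drops by at most one per step, so some factor is zero. -/
theorem slotProd_eq_zero {c : ℤ} {l : List Dale} (hl : l.Pairwise (· ≤ ·)) (hl0 : l ≠ [])
    (hlow : ∀ e ∈ l, c ≤ rank e) (hup : ∀ e ∈ l, (rank e : ℤ) ≤ c + l.length - 1) :
    slotProd c l = 0 := by
  induction l generalizing c with
  | nil => exact absurd rfl hl0
  | cons x l ih =>
    rw [List.pairwise_cons] at hl
    rw [List.forall_mem_cons] at hlow hup
    rw [slotProd]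
    rcases hlow.1.eq_or_lt with hx | hx
    · rw [hx]; simp
    · rw [ih hl.2, mul_zero]
      · rintro rfl
        simp at hup
        omega
      · intro e he
        have := rank_mono (hl.1 e he)
        omega
      · intro e he
        have := hup.2 e he
        rw [List.length_cons] at this
        push_cast at this
        linarith

/-- In a sorted list the last entry also attains the extreme rank, so the last factor is zero. -/
theorem slotProd_eq_zero_of_mem {c : ℤ} {l : List Dale} (hl : l.Pairwise (· ≤ ·))
    (hup : ∀ e ∈ l, (rank e : ℤ) ≤ c + l.length - 1)
    (hmem : ∃ e ∈ l, (rank e : ℤ) = c + l.length - 1) : slotProd c l = 0 := by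
  induction l generalizing c with
  | nil => simp at hmem
  | cons x l ih =>
    rw [List.pairwise_cons] at hl
    rw [List.forall_mem_cons] at hup
    rw [slotProd]
    obtain ⟨e, he, hr⟩ := hmem
    rw [List.length_cons] at hr hup
    push_cast at hr hup
    cases l with
    | nil =>
      obtain rfl : e = x := by simpa using he
      simp at hr
      rw [hr]; simp
    | cons y l =>
      rw [ih hl.2, mul_zero]
      · intro e he
        have := hup.2 e he
        linarith
      · rcases List.mem_cons.1 he with rfl | he
        · refine ⟨y, by simp, ?_⟩
          have h1 := rank_mono (hl.1 y (by simp))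
          have h2 := hup.2 y (by simp)
          zify at h1
          linarith
        · exact ⟨e, he, by linarith⟩

theorem sort_erase (B : Finset Dale) (e : Dale) :
    (B.erase e).sort (· ≤ ·) = (B.sort (· ≤ ·)).erase e := by
  have hnd : ((B.sort (· ≤ ·)).erase e).Nodup := (Finset.sort_nodup B _).erase e
  have h1 : ((B.sort (· ≤ ·)).erase e).toFinset = B.erase e := by
    ext x
    simp [(Finset.sort_nodup B (· ≤ ·)).mem_erase_iff]
  rw [← h1]
  exact (List.toFinset_sort _ hnd).2 ((Finset.pairwise_sort B _).sublist List.erase_sublist)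

theorem dalesCount_eq_zero_of_rank {m : ℕ} (hm : 2 ≤ m) {D : Finset Dale} {e : Dale} (he : e ∈ D)
    (h : m ≤ rank e) : dalesCount m D = 0 := by
  rw [dalesCount, Finset.card_eq_zero, Finset.filter_eq_empty_iff]
  rintro w hw rfl
  exact (rank_lt_of_mem_rootedDales hm (mem_orderings.1 hw) he).2.not_ge h

theorem dalesCount_eq_zero_of_notMem {m : ℕ} (hm : 2 ≤ m) {D : Finset Dale}
    (h : ¬ {left 1, right 1} ⊆ D) : dalesCount m D = 0 := by
  rw [dalesCount, Finset.card_eq_zero, Finset.filter_eq_empty_iff]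
  rintro w hw rfl
  exact h (rank_one_subset_rootedDales hm (mem_orderings.1 hw))

theorem dalesCount_two : dalesCount 2 {left 1, right 1} = 1 := by
  rw [dalesCount, Finset.card_eq_one]
  refine ⟨[2], ?_⟩
  ext w
  rw [Finset.mem_filter, mem_orderings, Finset.mem_singleton]
  constructor
  · rintro ⟨h, -⟩
    have h1 := List.toFinset_card_of_nodup h.1
    rw [h.2] at h1
    obtain ⟨a, rfl⟩ := List.length_eq_one_iff.1 (h1.symm.trans (by simp))
    have := Finset.mem_Icc.1 (h.mem_iff.1 (List.mem_singleton_self a))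
    rw [show a = 2 by omega]
  · rintro rfl
    refine ⟨⟨by simp, by rfl⟩, ?_⟩
    simp [rootedDales, pairDale, Finset.pair_comm]

/-- Induction by the insertion recursion and the telescoping sum. The offset 3 suits both
boundaries: offset 2 kills the product for ranks from 2 to `k + 1`, and offset 3 kills it when rank
`k + 2` occurs among `k` dales, where no cycle on `1, …, k + 2` exists. -/
theorem dalesCount_eq_slotProd {k : ℕ} {B : Finset Dale} (hcard : B.card = k)
    (hB : ∀ e ∈ B, 2 ≤ rank e ∧ rank e ≤ k + 1) :
    (dalesCount (k + 2) (B ∪ {left 1, right 1}) : ℤ) = slotProd 3 (B.sort (· ≤ ·)) := by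
  induction k generalizing B with
  | zero =>
    obtain rfl := Finset.card_eq_zero.1 hcard
    simp [dalesCount_two, slotProd]
  | succ k ih =>
    have hdisj : Disjoint B {left 1, right 1} := by
      rw [Finset.disjoint_right]
      intro e he he'
      have := (hB e he').1
      simp only [Finset.mem_insert, Finset.mem_singleton] at he
      rcases he with rfl | rfl <;> simp at this
    rw [dalesCount_succ (by omega), Finset.sum_union hdisj]
    · have h0 : ∑ e ∈ ({left 1, right 1} : Finset Dale),
          dalesCount (k + 2) ((B ∪ {left 1, right 1}).erase e) = 0 := by
        refine Finset.sum_eq_zero fun e he => dalesCount_eq_zero_of_notMem (by omega) fun h => ?_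
        simpa using h he
      have h1 : ∀ e ∈ B, ((dalesCount (k + 2) ((B ∪ {left 1, right 1}).erase e) : ℕ) : ℤ) =
          slotProd 3 ((B.sort (· ≤ ·)).erase e) := by
        intro e he
        rw [← sort_erase, Finset.erase_union_distrib,
          Finset.erase_eq_of_notMem (Finset.disjoint_left.1 hdisj he)]
        have hc : (B.erase e).card = k := by rw [Finset.card_erase_of_mem he, hcard]; rfl
        -- If a remaining dale still has rank `k + 2`, the induction hypothesis does not apply, but
        -- both sides are zero.
        by_cases hmax : ∀ x ∈ B.erase e, rank x ≤ k + 1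
        · exact ih hc fun x hx => ⟨(hB x (Finset.mem_of_mem_erase hx)).1, hmax x hx⟩
        · push Not at hmax
          obtain ⟨x, hx, hxk⟩ := hmax
          have hxk' := (hB x (Finset.mem_of_mem_erase hx)).2
          rw [dalesCount_eq_zero_of_rank (by omega) (Finset.mem_union_left _ hx) (by omega),
            slotProd_eq_zero_of_mem (Finset.pairwise_sort _ _)]
          · rfl
          · intro z hz
            have := (hB z (Finset.mem_of_mem_erase ((Finset.mem_sort _).1 hz))).2
            rw [Finset.length_sort, hc]
            omega
          · refine ⟨x, (Finset.mem_sort _).2 hx, ?_⟩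
            rw [Finset.length_sort, hc]
            omega
      rw [h0, add_zero, Nat.cast_sum, Finset.sum_congr rfl h1]
      have h2 := List.sum_toFinset (fun e => slotProd 3 ((B.sort (· ≤ ·)).erase e))
        (Finset.sort_nodup B (· ≤ ·))
      rw [Finset.sort_toFinset] at h2
      rw [h2, sum_slotProd_erase _ (Finset.sort_nodup B _),
        slotProd_eq_zero (c := 3 - 1) (Finset.pairwise_sort B _), sub_zero]
      · rw [← List.length_pos_iff_ne_nil, Finset.length_sort]; omega
      · intro e he
        have := (hB e ((Finset.mem_sort _).1 he)).1
        omega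
      · intro e he
        have := (hB e ((Finset.mem_sort _).1 he)).2
        rw [Finset.length_sort, hcard]
        push_cast
        omega
    · intro e he
      rcases Finset.mem_union.1 he with he | he
      · have := hB e he; omega
      · simp only [Finset.mem_insert, Finset.mem_singleton] at he
        rcases he with rfl | rfl <;> simp

theorem slotProd_sort_eq_prod {d : ℕ} {B : Finset Dale} (hcard : B.card = d - 1) :
    slotProd 3 (B.sort (· ≤ ·)) =
      ∏ i ∈ Finset.range (d - 1), ((d : ℤ) + 1 - i - rk B (d - 1 - i)) := by
  rw [slotProd_eq_prod, Finset.length_sort, hcard, ← Finset.prod_range_reflect]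
  refine Finset.prod_congr rfl fun i hi => ?_
  rw [Finset.mem_range] at hi
  have h1 : d - 1 - i - 1 = d - 1 - 1 - i := by omega
  rw [rk, h1, rank]
  have h2 : ((d - 1 - 1 - i : ℕ) : ℤ) = d - 2 - i := by omega
  rw [h2]
  ring

/-! ### Assembling the count -/

theorem rank_of_mem_master {d : ℕ} {e : Dale} (he : e ∈ master d \ {left 1, right 1}) :
    2 ≤ rank e ∧ rank e ≤ d := by
  simp only [master, Finset.mem_sdiff, Finset.mem_union, Finset.mem_image, Finset.mem_Icc,
    Finset.mem_insert, Finset.mem_singleton, not_or] at he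
  obtain ⟨⟨i, hi, rfl⟩ | ⟨i, hi, rfl⟩, h1, h2⟩ := he
  · rw [left_inj] at h1
    rw [rank_left]; omega
  · rw [right_inj] at h2
    rw [rank_right]; omega

theorem mem_master {d : ℕ} {e : Dale} (h1 : 1 ≤ rank e) (h2 : rank e ≤ d) : e ∈ master d := by
  rcases eq_left_or_right e with ⟨i, rfl⟩ | ⟨i, rfl⟩
  · exact Finset.mem_union_left _ (Finset.mem_image_of_mem _ (Finset.mem_Icc.2 ⟨h1, h2⟩))
  · exact Finset.mem_union_right _ (Finset.mem_image_of_mem _ (Finset.mem_Icc.2 ⟨h1, h2⟩))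

theorem daleSet_coe_one_cons {d : ℕ} (hd : 1 ≤ d) {w : List ℕ}
    (h : IsOrdering (Finset.Icc 2 (d + 1)) w) :
    daleSet d ((1 :: w : List ℕ) : Cycle ℕ) = rootedDales w ∧ (rootedDales w).card = d + 1 := by
  have h' : IsOrdering (Finset.Icc 1 (d + 1)) (1 :: w) := by
    have e : insert 1 (Finset.Icc 2 (d + 1)) = Finset.Icc 1 (d + 1) := by ext; simp; omega
    rw [← e]
    exact h.cons (by simp)
  have hw := ne_nil_of_isOrdering (by omega) h
  have e := daleSet_coe_cons h' hw
  exact ⟨e, by rw [rootedDales, ← e, card_daleSet_coe_cons h' hw]⟩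

/-- The cyclic orderings of `1, …, d + 1` whose dale rank set satisfies `P`. -/
def cyclesWith (d : ℕ) (P : Finset Dale → Prop) : Set (Cycle ℕ) :=
  {τ | IsCyclicPerm (d + 1) τ ∧ P (daleSet d τ)}

theorem ncard_cyclesWith {d x : ℕ} (hx : x ∈ Finset.Icc 1 (d + 1)) (P : Finset Dale → Prop) :
    (cyclesWith d P).ncard = {l | IsOrdering ((Finset.Icc 1 (d + 1)).erase x) l ∧
      P (daleSet d ((x :: l : List ℕ) : Cycle ℕ))}.ncard := by
  have hb := bijOn_coe_cons hx
  rw [← Set.InjOn.ncard_image (hb.injOn.mono fun l hl => hl.1)]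
  congr 1
  ext τ
  constructor
  · rintro ⟨h1, h2⟩
    obtain ⟨l, hl, rfl⟩ := hb.surjOn h1
    exact ⟨l, ⟨hl, h2⟩, rfl⟩
  · rintro ⟨l, ⟨hl, h2⟩, rfl⟩
    exact ⟨hb.mapsTo hl, h2⟩

theorem ncard_admissibleOrderings {n : ℕ} {S : Finset ℕ} (hS : S ⊆ Finset.Icc 1 n)
    (hS0 : S.Nonempty) :
    (admissibleOrderings n S).ncard = (cyclesWith S.card (Fits n S)).ncard := by
  rw [ncard_cyclesWith (x := S.card + 1) (by simp)]
  have e : (Finset.Icc 1 (S.card + 1)).erase (S.card + 1) = Finset.Icc 1 S.card := by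
    ext; simp
  rw [e]
  have hinj : Set.InjOn (List.map (s n S)) {l | IsOrdering (Finset.Icc 1 S.card) l ∧
      Fits n S (daleSet S.card (((S.card + 1) :: l : List ℕ) : Cycle ℕ))} := by
    rintro l ⟨hl, -⟩ l' ⟨hl', -⟩ h
    have hleft : ∀ l : List ℕ, IsOrdering (Finset.Icc 1 S.card) l → (l.map (s n S)).map
        (Function.invFunOn (s n S) {x | x ∈ Finset.Icc 1 S.card}) = l := by
      intro l hl
      rw [List.map_map]
      refine (List.map_congr_left fun x hx => ?_).trans (List.map_id l)
      exact (injOn_s hS).leftInvOn_invFunOn (hl.mem_iff.1 hx)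
    rw [← hleft l hl, h, hleft l' hl']
  rw [← hinj.ncard_image]
  congr 1
  ext σ
  constructor
  · intro hσ
    have hσS := hσ.1
    choose! g hg using fun x (hx : x ∈ S) =>
      Finset.mem_image.1 ((image_s_Icc n S).ge hx)
    have hmap : (σ.map g).map (s n S) = σ := by
      rw [List.map_map]
      refine (List.map_congr_left fun x hx => ?_).trans (List.map_id σ)
      exact (hg x (hσS.mem_iff.1 hx)).2
    have ht : IsOrdering (Finset.Icc 1 S.card) (σ.map g) := by
      refine ⟨List.Nodup.of_map (s n S) (by rw [hmap]; exact hσS.1), ?_⟩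
      ext i
      simp only [List.mem_toFinset, List.mem_map, hσS.mem_iff]
      constructor
      · rintro ⟨x, hx, rfl⟩
        exact (hg x hx).1
      · intro hi
        have hx := (image_s_Icc n S).le (Finset.mem_image_of_mem (s n S) hi)
        exact ⟨_, hx, injOn_s hS (hg _ hx).1 hi (hg _ hx).2⟩
    refine ⟨σ.map g, ⟨ht, ?_⟩, hmap⟩
    rw [← mem_admissibleOrderings_iff hS hS0 ht, hmap]
    exact hσ
  · rintro ⟨t, ⟨ht, h⟩, rfl⟩
    exact (mem_admissibleOrderings_iff hS hS0 ht).2 h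

/-- Cycles are rooted at 1 and grouped by their dale set without `1_l`, `1_r`. A dale set always has
`d + 1` elements including these two, so `d - 1` elements of `D'` remain; `Fits` depends only on the
dale set and is constant on each group. -/
theorem ncard_cyclesWith_eq_sum {d : ℕ} (hd : 1 ≤ d) (n : ℕ) (S : Finset ℕ) :
    ((cyclesWith d (Fits n S)).ncard : ℤ) =
      ∑ B ∈ (master d \ {left 1, right 1}).powersetCard (d - 1),
        delta n S (B ∪ {left 1, right 1}) * dalesCount (d + 1) (B ∪ {left 1, right 1}) := by
  classical
  rw [ncard_cyclesWith (x := 1) (by simp)]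
  have e : (Finset.Icc 1 (d + 1)).erase 1 = Finset.Icc 2 (d + 1) := by ext; simp; omega
  have h1 : {l | IsOrdering ((Finset.Icc 1 (d + 1)).erase 1) l ∧
      Fits n S (daleSet d ((1 :: l : List ℕ) : Cycle ℕ))} =
      ↑((orderings (Finset.Icc 2 (d + 1))).filter (fun w => Fits n S (rootedDales w))) := by
    ext w
    rw [e, Finset.coe_filter]
    simp only [Set.mem_ofPred_eq, mem_orderings]
    exact and_congr_right fun h => by rw [(daleSet_coe_one_cons hd h).1]
  rw [h1, Set.ncard_coe_finset]
  have hsub : ∀ {w}, IsOrdering (Finset.Icc 2 (d + 1)) w →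
      rootedDales w \ {left 1, right 1} ∪ {left 1, right 1} = rootedDales w := fun h =>
    Finset.sdiff_union_of_subset (rank_one_subset_rootedDales (by omega) h)
  rw [Finset.card_eq_sum_card_fiberwise (f := fun w => rootedDales w \ {left 1, right 1})
    (t := (master d \ {left 1, right 1}).powersetCard (d - 1))]
  · rw [Nat.cast_sum]
    refine Finset.sum_congr rfl fun B hB => ?_
    have hBm := (Finset.mem_powersetCard.1 hB).1
    have hfib : ∀ w ∈ orderings (Finset.Icc 2 (d + 1)),
        (rootedDales w \ {left 1, right 1} = B ↔ rootedDales w = B ∪ {left 1, right 1}) := by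
      intro w hw
      constructor
      · rintro rfl
        exact (hsub (mem_orderings.1 hw)).symm
      · intro h
        rw [h, Finset.union_sdiff_right, Finset.sdiff_eq_self_iff_disjoint]
        exact Finset.disjoint_of_subset_left hBm Finset.sdiff_disjoint
    rw [Finset.filter_filter, delta, dalesCount]
    split_ifs with hfit
    · rw [one_mul]
      congr 2
      refine Finset.filter_congr fun w hw => ?_
      rw [hfib w hw]
      exact ⟨fun h => h.2, fun h => ⟨h ▸ hfit, h⟩⟩
    · rw [zero_mul, Nat.cast_eq_zero, Finset.card_eq_zero, Finset.filter_eq_empty_iff]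
      rintro w hw ⟨h, h'⟩
      rw [hfib w hw] at h'
      exact hfit (h' ▸ h)
  · intro w hw
    have hw' := mem_orderings.1 (Finset.mem_filter.1 hw).1
    rw [Finset.mem_coe, Finset.mem_powersetCard]
    constructor
    · refine Finset.sdiff_subset_sdiff (fun x hx => ?_) le_rfl
      have := rank_lt_of_mem_rootedDales (by omega) hw' hx
      exact mem_master this.1 (by omega)
    · rw [Finset.card_sdiff_of_subset (rank_one_subset_rootedDales (by omega) hw'),
        (daleSet_coe_one_cons hd hw').2, Finset.card_pair (left_ne_right 1 1)]
      omega

end Pinnacle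

open Pinnacle
theorem mainTheorem5 (n d : ℕ) (S : Finset ℕ) (hd : 1 ≤ d) (hcard : S.card = d)
    (hadm : IsAdmissibleSet S) (hn : ∀ x ∈ S, x ≤ n) :
    (∀ τ : Cycle ℕ, IsCyclicPerm (d + 1) τ →
      (IsAdmissibleCyclic n S τ ↔
        ∀ j ∈ Finset.Icc 1 (d + 1),
          j ≤ ∑ i ∈ Finset.range (rk (daleSet d τ) j), gap n S i)) ∧
    ((admissibleOrderings n S).ncard : ℤ) =
      ∑ B ∈ (master d \ {left 1, right 1}).powersetCard (d - 1),
        delta n S (B ∪ {left 1, right 1}) *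
          ∏ i ∈ Finset.range (d - 1), ((d : ℤ) + 1 - i - rk B (d - 1 - i)) := by
  have hS0 : S.Nonempty := Finset.card_pos.1 (by omega)
  have hS : S ⊆ Finset.Icc 1 n := by
    intro x hx
    obtain ⟨m, π, hπ, hpin⟩ := hadm
    have : x ∈ pin π := by rw [hpin]; exact hx
    obtain ⟨a, b, h, -⟩ := this
    exact Finset.mem_Icc.2
      ⟨(Finset.mem_Icc.1 (hπ.mem_iff.1 (h.subset (by simp)))).1, hn x hx⟩
  subst hcard
  constructor
  · intro τ hτ
    obtain ⟨t, ht, rfl⟩ := (bijOn_coe_cons (A := Finset.Icc 1 (S.card + 1))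
      (x := S.card + 1) (by simp)).surjOn hτ
    have e : (Finset.Icc 1 (S.card + 1)).erase (S.card + 1) = Finset.Icc 1 S.card := by
      ext; simp
    have ht' : IsOrdering (Finset.Icc 1 S.card) t := by rw [← e]; exact ht
    have ht0 : t ≠ [] := by
      rintro rfl
      simpa using ht'.mem_iff.2 (Finset.mem_Icc.2 ⟨le_rfl, hd⟩)
    have hord : IsOrdering (Finset.Icc 1 (S.card + 1)) ((S.card + 1) :: t) := by
      rw [← insert_Icc_one]
      exact ht'.cons (by simp)
    rw [isAdmissibleCyclic_coe_cons_iff hS hS0 ht', mem_admissibleOrderings_iff hS hS0 ht', Fits,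
      card_daleSet_coe_cons hord ht0]
  · rw [ncard_admissibleOrderings hS hS0, ncard_cyclesWith_eq_sum hd]
    refine Finset.sum_congr rfl fun B hB => ?_
    obtain ⟨hB1, hB2⟩ := Finset.mem_powersetCard.1 hB
    rw [← slotProd_sort_eq_prod hB2, ← dalesCount_eq_slotProd hB2]
    · rw [show S.card - 1 + 2 = S.card + 1 by omega]
    · intro x hx
      have := rank_of_mem_master (hB1 hx)
      omega
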